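/- **Terms.** Fix a set of constants and a set of instantiatable variables. De Bruijn terms are generated by constants $c$, instantiatable variables $x$, variable references $\#i$ ($i\ge 1$), applications $(t_1\ t_2)$ and abstractions $(\lambda\,t)$; $\beta$-reduction is the usual one, $((\lambda\,t_1)\ t_2)\to S(t_1;t_2,\#1,\#2,\dots)$, where $S(t;s_1,s_2,\dots)$ is simultaneous substitution, applied to any subterm. *Suspension terms* have in addition the form $[\![t,ol,nl,e]\!]$ with $ol,nl\in\mathbb N$ and an environment $e$, a finite list of items $@l$ or $(t,l)$ with $l\in\mathbb N$ and $t$ a suspension term; $e[i]$ is the $i$th item. Say that $e$ *fits* $n$ if $l<n$ for each item $@l$ of $e$ and $l\le n$ for each item $(t,l)$ of $e$. A suspension term is *well-formed* if each suspension $[\![t,ol,nl,e]\!]$ occurring in it (also inside environments) satisfies: $e$ has length $ol$; $e$ fits $nl$; and if $e=@l::e'$ with $nl=l+1$, then $e'$ fits $l$. **Rules.** The reading rules are (r1) $[\![c,ol,nl,e]\!]\to c$; (r2) $[\![x,ol,nl,e]\!]\to x$; (r3) $[\![\#i,ol,nl,e]\!]\to\#(i-ol+nl)$ if $i>ol$;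 (r4) $[\![\#i,ol,nl,e]\!]\to\#(nl-l)$ if $i\le ol$ and $e[i]=@l$ (with $l<nl$); (r5) $[\![\#i,ol,nl,e]\!]\to[\![t,0,nl-l,nil]\!]$ if $i\le ol$ and $e[i]=(t,l)$ (with $l\le nl$); (r6) $[\![(t_1\ t_2),ol,nl,e]\!]\to([\![t_1,ol,nl,e]\!]\ [\![t_2,ol,nl,e]\!])$; (r7) $[\![(\lambda\,t),ol,nl,e]\!]\to(\lambda\,[\![t,ol+1,nl+1,@nl::e]\!])$; (r8) $[\![[\![t,ol,nl,e]\!],0,nl',nil]\!]\to[\![t,ol,nl+nl',e]\!]$; (r9) $[\![t,0,0,nil]\!]\to t$; and the enhanced versions of (r5), for $i\le ol$: (r10) $[\![\#i,ol,nl,e]\!]\to t$ if $e[i]=(t,nl)$; (r11) $[\![\#i,ol,nl,e]\!]\to[\![t,ol',nl'+nl-l,e']\!]$ if $e[i]=([\![t,ol',nl',e']\!],l)$ and $l<nl$; (r12) $[\![\#i,ol,nl,e]\!]\to[\![t,0,nl-l,nil]\!]$ if $e[i]=(t,l)$, $t$ is not a suspension and $l<nl$. The remaining rules are $(\beta_s)$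 $((\lambda\,t_1)\ t_2)\to[\![t_1,1,0,(t_2,0)::nil]\!]$ and $(\beta'_s)$ $((\lambda\,[\![t_1,ol+1,nl+1,@nl::e]\!])\ t_2)\to[\![t_1,ol+1,nl,(t_2,nl)::e]\!]$. Rules may be applied to any subterm, also inside environments. A *generalized head normal form* is a suspension term $(\lambda\cdots(\lambda\,(\cdots(h\ t_1)\cdots t_m))\cdots)$ with $n\ge0$ abstractions, whose head $h$ is a constant, an instantiatable variable or a variable reference and whose arguments $t_1,\dots,t_m$, $m\ge 0$, are arbitrary suspension terms; a head normal form of a de Bruijn term is a de Bruijn term of this form to which it $\beta$-reduces. **Procedure.** On a heap of mutable cells, a reference represents a suspension term if the finite acyclic graph below it, with possible sharing, unfolds to this term; a cell holds `const c`, `fv x`, `bv i` (for $\#i$), `lam t`, `app(t1,t2)`, `susp(t,ol,nl,env)` or an indirection `ptr t`, where `t`, `t1`, `t2` are references and `env` is a list of items `dum l` (for $@l$) and `bndg(t,l)` (for $(t,l)$). The procedures are the following Standard ML functions (clauses tried in order). ``` fun deref(term as ref(ptr(t))) = deref(t) | deref(term) = term fun assign(t1,ref(ptr(t))) = assign(t1,t)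 | assign(t1,t2) = t1 := ptr(t2) fun nth(x::l,1) = x | nth(x::l,n) = nth(l,n-1) fun lazy_read(term as ref(susp(t,ol,nl,env))) = lazy_read_aux(term,deref(t),ol,nl,env) | lazy_read(_) = () and lazy_read_aux(t1,ref(bv(i)),ol,nl,env) = if i > ol then t1 := bv(i + nl - ol) else ((fn dum(l) => t1 := bv(nl - l) | bndg(t2,l) => ((if (nl = l) then assign(t1,t2) else ((fn ref(susp(t3,ol',nl',e')) => t1 := susp(t3,ol',nl' + nl - l,e') | t => t1 := susp(t,0,nl - l,nil)) (deref t2))); lazy_read t1)) (nth(env,i))) | lazy_read_aux(t1,ref(app(t2,t3)),ol,nl,env) = t1 := app(ref(susp(t2,ol,nl,env)),ref(susp(t3,ol,nl,env))) | lazy_read_aux(t1,ref(lam(t2)),ol,nl,env) = t1 := lam(ref(susp(t2,ol+1,nl+1,dum(nl)::env))) | lazy_read_aux(t1,t as ref(susp(_,_,_,_)),ol,nl,env) = (lazy_read(t) ; lazy_read_aux(t1,deref(t),ol,nl,env)) | lazy_read_aux(t1,t2,_,_,_) = t1 := !t2 fun beta_contract(term,t1 as ref(susp(t3,ol,nl,dum(nl1)::e)),t2)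 = if nl = nl1+1 then term := susp(t3,ol,nl1,bndg(t2,nl1)::e) else term := susp(t1,1,0,[bndg(t2,0)]) | beta_contract(term,t1,t2) = term := susp(t1,1,0,[bndg(t2,0)]) fun hn_ex(term as ref(app(t1,t2)),whnf) = (hn_ex(t1,true) ; (fn ref(lam(t)) => (beta_contract(term,t,t2); hn_ex(term,whnf)) | _ => ()) (deref t1)) | hn_ex(ref(lam(t)),false) = hn_ex(t,false) | hn_ex(term as ref(susp(_,_,_,_)),whnf) = (lazy_read(term) ; hn_ex(term,whnf)) | hn_ex(term as ref(ptr(t)),whnf) = (hn_ex(t,whnf) ; assign(term,t)) | hn_ex(_,_) = () fun head_norm2(t) = hn_ex(t,false) ``` **Theorem (correctness of head\_norm2).** Let $r$ be a reference that represents, in some heap, a well-formed suspension term $t$, and suppose that reading rules transform $t$ to a de Bruijn term that has a head normal form. Then head\_norm2$(r)$ terminates and, when it does, $r$ represents a generalized head normal form of $t$, that is, a generalized head normal form $s$ such that $t$ can be rewritten to $s$ by a finite (maybe empty) series of applications of (r1)-(r12), $(\beta_s)$ and $(\beta'_s)$. -/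

import Mathlib

namespace SuspNotation

open Relation

/-! ### De Bruijn terms

Throughout, `C` is the set of constants and `V` the set of instantiatable variables.
The variable reference `#i`, for a positive number `i`, is `bvar (i - 1)`; so `bvar n` is `#(n+1)`. -/

/-- De Bruijn terms. -/
inductive DB (C V : Type) : Type
  | const (c : C) : DB C V
  | fvar (x : V) : DB C V
  | bvar (n : ℕ) : DB C V
  | app (t₁ t₂ : DB C V) : DB C V
  | lam (t : DB C V) : DB C V

namespace DB

variable {C V : Type}

/-- Renumbering of the free variables of a de Bruijn term. -/
def rename : DB C V → (ℕ → ℕ) → DB C V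
  | const c, _ => const c
  | fvar x, _ => fvar x
  | bvar n, ρ => bvar (ρ n)
  | app t₁ t₂, ρ => app (t₁.rename ρ) (t₂.rename ρ)
  | lam t, ρ => lam (t.rename fun n => Nat.casesOn n 0 fun k => ρ k + 1)

/-- The simultaneous substitution `S(t; s₁, s₂, …)`, where `s n` is `s_{n+1}`. Under an abstraction
the sequence becomes `#1, s₁', s₂', …` with `sᵢ' = S(sᵢ; #2, #3, …)`; the latter is written as a
renumbering, which is the same by `rename_eq_subst`. -/
def subst : DB C V → (ℕ → DB C V) → DB C V
  | const c, _ => const c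
  | fvar x, _ => fvar x
  | bvar n, s => s n
  | app t₁ t₂, s => app (t₁.subst s) (t₂.subst s)
  | lam t, s => lam (t.subst fun n => Nat.casesOn n (bvar 0) fun k => (s k).rename Nat.succ)

theorem rename_eq_subst (t : DB C V) :
    ∀ ρ : ℕ → ℕ, t.rename ρ = t.subst fun n => bvar (ρ n) := by
  induction t with
  | const c => intro ρ; rfl
  | fvar x => intro ρ; rfl
  | bvar n => intro ρ; rfl
  | app t₁ t₂ ih₁ ih₂ => intro ρ; simp [rename, subst, ih₁, ih₂]
  | lam t ih =>
    intro ρ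
    simp only [rename, subst, ih]
    congr 2
    funext n
    cases n <;> rfl

/-- The one-step reduction relation generated by `((λ t₁) t₂) → S(t₁; t₂, #1, #2, …)`. -/
inductive Beta : DB C V → DB C V → Prop
  | beta (t₁ t₂ : DB C V) :
      Beta (app (lam t₁) t₂) (t₁.subst fun n => Nat.casesOn n t₂ fun k => bvar k)
  | appL {t₁ t₁' : DB C V} (t₂ : DB C V) : Beta t₁ t₁' → Beta (app t₁ t₂) (app t₁' t₂)
  | appR (t₁ : DB C V) {t₂ t₂' : DB C V} : Beta t₂ t₂' → Beta (app t₁ t₂) (app t₁ t₂')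
  | lam {t t' : DB C V} : Beta t t' → Beta (lam t) (lam t')

/-- Terms `(… (h t₁) … tₘ)` whose head `h` is a constant, an instantiatable variable or a
variable reference. -/
inductive Neutral : DB C V → Prop
  | const (c : C) : Neutral (const c)
  | fvar (x : V) : Neutral (fvar x)
  | bvar (n : ℕ) : Neutral (bvar n)
  | app {t₁ : DB C V} (t₂ : DB C V) : Neutral t₁ → Neutral (app t₁ t₂)

/-- Head normal forms `(λ … (λ (… (h t₁) … tₘ)) …)`. -/
inductive HNF : DB C V → Prop
  | neutral {t : DB C V} : Neutral t → HNF t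
  | lam {t : DB C V} : HNF t → HNF (lam t)

/-- The term has a head normal form. -/
def HasHNF (t : DB C V) : Prop := ∃ s : DB C V, ReflTransGen Beta t s ∧ HNF s

end DB

/-! ### Suspension terms -/

mutual

/-- Suspension terms; `susp t ol nl e` is `⟦t, ol, nl, e⟧`. -/
inductive STerm (C V : Type) : Type
  | const (c : C) : STerm C V
  | fvar (x : V) : STerm C V
  | bvar (n : ℕ) : STerm C V
  | app (t₁ t₂ : STerm C V) : STerm C V
  | lam (t : STerm C V) : STerm C V
  | susp (t : STerm C V) (ol nl : ℕ) (e : Env C V) : STerm C V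

/-- Environments. -/
inductive Env (C V : Type) : Type
  | nil : Env C V
  | cons (et : ETerm C V) (e : Env C V) : Env C V

/-- Environment terms; `dum l` is `@l` and `bnd t l` is `(t, l)`. -/
inductive ETerm (C V : Type) : Type
  | dum (l : ℕ) : ETerm C V
  | bnd (t : STerm C V) (l : ℕ) : ETerm C V

end

/-- De Bruijn terms are suspension terms. -/
def DB.toSTerm {C V : Type} : DB C V → STerm C V
  | .const c => .const c
  | .fvar x => .fvar x
  | .bvar n => .bvar n
  | .app t₁ t₂ => .app t₁.toSTerm t₂.toSTerm
  | .lam t => .lam t.toSTerm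

namespace Env

variable {C V : Type}

/-- Length of an environment. -/
def length : Env C V → ℕ
  | nil => 0
  | cons _ e => e.length + 1

/-- The `n`th item, counted from `0`: `e[i]` is `e.get? (i - 1)`. -/
def get? : Env C V → ℕ → Option (ETerm C V)
  | nil, _ => none
  | cons et _, 0 => some et
  | cons _ e, n + 1 => e.get? n

/-- The constraint that the embedding level `nl` puts on the items of an environment:
`l < nl` for each item `@l` and `l ≤ nl` for each item `(t, l)`. -/
def Fits (nl : ℕ) : Env C V → Prop
  | nil => True
  | cons (.dum l) e => l < nl ∧ e.Fits nl
  | cons (.bnd _ l) e => l ≤ nl ∧ e.Fits nl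

end Env

mutual

/-- Well-formedness, required of all suspensions `⟦t, ol, nl, e⟧` inside the term, also of those
inside environments: `e` has length `ol` and is compatible with the embedding level `nl`; and if
`e` is `@l :: e'` with `nl = l + 1`, as in a suspension that was pushed into an abstraction, then
`e'` is compatible with the embedding level `l` outside that abstraction. -/
def STerm.WF {C V : Type} : STerm C V → Prop
  | .const _ => True
  | .fvar _ => True
  | .bvar _ => True
  | .app t₁ t₂ => t₁.WF ∧ t₂.WF
  | .lam t => t.WF
  | .susp t ol nl e => t.WF ∧ e.WF ∧ e.length = ol ∧ e.Fits nl ∧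
      ∀ (l : ℕ) (e' : Env C V), e = .cons (.dum l) e' → nl = l + 1 → e'.Fits l

/-- All terms in the environment are well-formed. -/
def Env.WF {C V : Type} : Env C V → Prop
  | .nil => True
  | .cons et e => et.WF ∧ e.WF

/-- The term in the environment item, if there is one, is well-formed. -/
def ETerm.WF {C V : Type} : ETerm C V → Prop
  | .dum _ => True
  | .bnd t _ => t.WF

end

/-! ### Rewrite rules -/

section Rules

variable {C V : Type}

/-- The reading rules (r1)-(r9), and (r10)-(r12), which are the enhanced version of (r5). -/
inductive ReadingRule : STerm C V → STerm C V → Prop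
  | r1 (c : C) (ol nl : ℕ) (e : Env C V) : ReadingRule (.susp (.const c) ol nl e) (.const c)
  | r2 (x : V) (ol nl : ℕ) (e : Env C V) : ReadingRule (.susp (.fvar x) ol nl e) (.fvar x)
  | r3 (k ol nl : ℕ) (e : Env C V) :
      ReadingRule (.susp (.bvar (ol + k)) ol nl e) (.bvar (k + nl))
  | r4 (n ol nl l m : ℕ) (e : Env C V) (hn : n < ol) (he : e.get? n = some (.dum l))
      (hm : nl = l + (m + 1)) :
      ReadingRule (.susp (.bvar n) ol nl e) (.bvar m)
  | r5 (n ol nl l j : ℕ) (e : Env C V) (t : STerm C V) (hn : n < ol)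
      (he : e.get? n = some (.bnd t l)) (hj : nl = l + j) :
      ReadingRule (.susp (.bvar n) ol nl e) (.susp t 0 j .nil)
  | r6 (t₁ t₂ : STerm C V) (ol nl : ℕ) (e : Env C V) :
      ReadingRule (.susp (.app t₁ t₂) ol nl e) (.app (.susp t₁ ol nl e) (.susp t₂ ol nl e))
  | r7 (t : STerm C V) (ol nl : ℕ) (e : Env C V) :
      ReadingRule (.susp (.lam t) ol nl e) (.lam (.susp t (ol + 1) (nl + 1) (.cons (.dum nl) e)))
  | r8 (t : STerm C V) (ol nl nl' : ℕ) (e : Env C V) :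
      ReadingRule (.susp (.susp t ol nl e) 0 nl' .nil) (.susp t ol (nl + nl') e)
  | r9 (t : STerm C V) : ReadingRule (.susp t 0 0 .nil) t
  | r10 (n ol nl : ℕ) (e : Env C V) (t : STerm C V) (hn : n < ol)
      (he : e.get? n = some (.bnd t nl)) :
      ReadingRule (.susp (.bvar n) ol nl e) t
  | r11 (n ol nl l j ol' nl' : ℕ) (e e' : Env C V) (t : STerm C V) (hn : n < ol)
      (he : e.get? n = some (.bnd (.susp t ol' nl' e') l)) (hj : nl = l + j) (hne : nl ≠ l) :
      ReadingRule (.susp (.bvar n) ol nl e) (.susp t ol' (nl' + j) e')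
  | r12 (n ol nl l j : ℕ) (e : Env C V) (t : STerm C V) (hn : n < ol)
      (he : e.get? n = some (.bnd t l)) (hj : nl = l + j) (hne : nl ≠ l)
      (ht : ∀ (t' : STerm C V) (ol' nl' : ℕ) (e' : Env C V), t ≠ .susp t' ol' nl' e') :
      ReadingRule (.susp (.bvar n) ol nl e) (.susp t 0 j .nil)

/-- The rules (βₛ) and (β'ₛ). -/
inductive BetaRule : STerm C V → STerm C V → Prop
  | beta (t₁ t₂ : STerm C V) :
      BetaRule (.app (.lam t₁) t₂) (.susp t₁ 1 0 (.cons (.bnd t₂ 0) .nil))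
  | beta' (t₁ t₂ : STerm C V) (ol nl : ℕ) (e : Env C V) :
      BetaRule (.app (.lam (.susp t₁ (ol + 1) (nl + 1) (.cons (.dum nl) e))) t₂)
        (.susp t₁ (ol + 1) nl (.cons (.bnd t₂ nl) e))

mutual

/-- Application of a rule of `R` to one subterm, possibly inside an environment. -/
inductive TermStep (R : STerm C V → STerm C V → Prop) : STerm C V → STerm C V → Prop
  | root {t t' : STerm C V} : R t t' → TermStep R t t'
  | appL {t₁ t₁' : STerm C V} (t₂ : STerm C V) :
      TermStep R t₁ t₁' → TermStep R (.app t₁ t₂) (.app t₁' t₂)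
  | appR (t₁ : STerm C V) {t₂ t₂' : STerm C V} :
      TermStep R t₂ t₂' → TermStep R (.app t₁ t₂) (.app t₁ t₂')
  | lam {t t' : STerm C V} : TermStep R t t' → TermStep R (.lam t) (.lam t')
  | suspT {t t' : STerm C V} (ol nl : ℕ) (e : Env C V) :
      TermStep R t t' → TermStep R (.susp t ol nl e) (.susp t' ol nl e)
  | suspE (t : STerm C V) (ol nl : ℕ) {e e' : Env C V} :
      EnvStep R e e' → TermStep R (.susp t ol nl e) (.susp t ol nl e')

/-- Application of a rule of `R` to one subterm inside an environment. -/
inductive EnvStep (R : STerm C V → STerm C V → Prop) : Env C V → Env C V → Prop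
  | head {t t' : STerm C V} (l : ℕ) (e : Env C V) :
      TermStep R t t' → EnvStep R (.cons (.bnd t l) e) (.cons (.bnd t' l) e)
  | tail (et : ETerm C V) {e e' : Env C V} :
      EnvStep R e e' → EnvStep R (.cons et e) (.cons et e')

end

/-- Finite (maybe empty) series of applications of reading rules. -/
def Reads : STerm C V → STerm C V → Prop := ReflTransGen (TermStep ReadingRule)

/-- Finite (maybe empty) series of applications of reading rules, (βₛ) and (β'ₛ). -/
def Rewrites : STerm C V → STerm C V → Prop :=
  ReflTransGen (TermStep fun t t' => ReadingRule t t' ∨ BetaRule t t')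

/-- Suspension terms `(… (h t₁) … tₘ)` whose head `h` is a constant, an instantiatable variable or
a variable reference; the arguments are arbitrary suspension terms. -/
inductive STerm.Neutral : STerm C V → Prop
  | const (c : C) : Neutral (.const c)
  | fvar (x : V) : Neutral (.fvar x)
  | bvar (n : ℕ) : Neutral (.bvar n)
  | app {t₁ : STerm C V} (t₂ : STerm C V) : Neutral t₁ → Neutral (.app t₁ t₂)

/-- Generalized head normal forms `(λ … (λ (… (h t₁) … tₘ)) …)`, where the arguments are arbitrary
suspension terms. -/
inductive STerm.GHNF : STerm C V → Prop
  | neutral {t : STerm C V} : STerm.Neutral t → GHNF t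
  | lam {t : STerm C V} : GHNF t → GHNF (.lam t)

end Rules

/-! ### Graph representation -/

/-- References, that is, heap locations. -/
abbrev Ref : Type := ℕ

/-- Environment items on the heap. -/
inductive EItem : Type
  | dum (l : ℤ) : EItem
  | bndg (t : Ref) (l : ℤ) : EItem

/-- Contents of a heap cell. -/
inductive RawTerm (C V : Type) : Type
  | const (c : C) : RawTerm C V
  | fv (x : V) : RawTerm C V
  | bv (i : ℤ) : RawTerm C V
  | ptr (t : Ref) : RawTerm C V
  | lam (t : Ref) : RawTerm C V
  | app (t₁ t₂ : Ref) : RawTerm C V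
  | susp (t : Ref) (ol nl : ℤ) (env : List EItem) : RawTerm C V

/-- A heap is a finite sequence of cells. The cell at location `r` of the heap `h` is `h[r]?`, an
assignment `r := v` turns `h` into `h.set r v`, and the allocation of a new cell with content `v`
turns `h` into `h ++ [v]` and yields the location `h.length`. -/
abbrev Heap (C V : Type) : Type := List (RawTerm C V)

section Heap

variable {C V : Type}

mutual

/-- In the heap `h`, the reference `r` represents the given suspension term. As the term is the
finite unfolding of the graph below `r`, this graph is acyclic; nodes may be shared. -/
inductive Represents (h : Heap C V) : Ref → STerm C V → Prop
  | const {r : Ref} {c : C} (hr : h[r]? = some (.const c)) : Represents h r (.const c)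
  | fv {r : Ref} {x : V} (hr : h[r]? = some (.fv x)) : Represents h r (.fvar x)
  | bv {r : Ref} {n : ℕ} (hr : h[r]? = some (.bv ((n : ℤ) + 1))) : Represents h r (.bvar n)
  | ptr {r r' : Ref} {t : STerm C V} (hr : h[r]? = some (.ptr r')) (ht : Represents h r' t) :
      Represents h r t
  | lam {r r' : Ref} {t : STerm C V} (hr : h[r]? = some (.lam r')) (ht : Represents h r' t) :
      Represents h r (.lam t)
  | app {r r₁ r₂ : Ref} {t₁ t₂ : STerm C V} (hr : h[r]? = some (.app r₁ r₂))
      (h₁ : Represents h r₁ t₁) (h₂ : Represents h r₂ t₂) : Represents h r (.app t₁ t₂)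
  | susp {r r' : Ref} {ol nl : ℕ} {env : List EItem} {t : STerm C V} {e : Env C V}
      (hr : h[r]? = some (.susp r' (ol : ℤ) (nl : ℤ) env)) (ht : Represents h r' t)
      (he : RepresentsEnv h env e) : Represents h r (.susp t ol nl e)

/-- In the heap `h`, the list of environment items represents the given environment. -/
inductive RepresentsEnv (h : Heap C V) : List EItem → Env C V → Prop
  | nil : RepresentsEnv h [] .nil
  | dum {l : ℕ} {env : List EItem} {e : Env C V} (he : RepresentsEnv h env e) :
      RepresentsEnv h (.dum (l : ℤ) :: env) (.cons (.dum l) e)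
  | bndg {r : Ref} {l : ℕ} {t : STerm C V} {env : List EItem} {e : Env C V}
      (ht : Represents h r t) (he : RepresentsEnv h env e) :
      RepresentsEnv h (.bndg r (l : ℤ) :: env) (.cons (.bnd t l) e)

end

/-! ### The procedures

Each procedure takes the current heap and yields `some` of the resulting heap (or value). It is the
least solution of its recursive equations, so it yields `none` exactly if the evaluation does not
terminate, or fails by an unmatched pattern or an invalid reference. -/

/-- Looks up the value of a term. -/
def deref (h : Heap C V) (term : Ref) : Option Ref := do
  match ← h[term]? with
  | .ptr t => deref h t
  | _ => some term
  partial_fixpoint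

/-- Assigns the term `t₂` to the term `t₁`. -/
def assign (h : Heap C V) (t₁ t₂ : Ref) : Option (Heap C V) := do
  match ← h[t₂]? with
  | .ptr t => assign h t₁ t
  | _ => some (h.set t₁ (.ptr t₂))
  partial_fixpoint

/-- The `n`th item of a list, counted from `1`. -/
def nth : List EItem → ℤ → Option EItem
  | [], _ => none
  | x :: l, n => if n = 1 then some x else nth l (n - 1)

mutual

/-- Exposes the top-level non-suspension structure of a suspension. -/
def lazyRead (h : Heap C V) (term : Ref) : Option (Heap C V) := do
  match ← h[term]? with
  | .susp t ol nl env =>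
    let t' ← deref h t
    lazyReadAux h term t' ol nl env
  | _ => some h
  partial_fixpoint

/-- Applies a reading rule to the suspension at `t₁`, whose term skeleton is at `t`, after exposing
the structure of `t`. -/
def lazyReadAux (h : Heap C V) (t₁ t : Ref) (ol nl : ℤ) (env : List EItem) :
    Option (Heap C V) := do
  match ← h[t]? with
  | .bv i =>
    if i > ol then some (h.set t₁ (.bv (i + nl - ol)))
    else
      match ← nth env i with
      | .dum l => some (h.set t₁ (.bv (nl - l)))
      | .bndg t₂ l =>
        if nl = l then
          let h' ← assign h t₁ t₂
          lazyRead h' t₁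
        else
          let t₂' ← deref h t₂
          match ← h[t₂']? with
          | .susp t₃ ol' nl' e' => lazyRead (h.set t₁ (.susp t₃ ol' (nl' + nl - l) e')) t₁
          | _ => lazyRead (h.set t₁ (.susp t₂' 0 (nl - l) [])) t₁
  | .app t₂ t₃ =>
    some ((h ++ [RawTerm.susp t₂ ol nl env, .susp t₃ ol nl env]).set t₁
      (.app h.length (h.length + 1)))
  | .lam t₂ =>
    some ((h ++ [RawTerm.susp t₂ (ol + 1) (nl + 1) (.dum nl :: env)]).set t₁ (.lam h.length))
  | .susp _ _ _ _ =>
    let h' ← lazyRead h t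
    let t' ← deref h' t
    lazyReadAux h' t₁ t' ol nl env
  | c => some (h.set t₁ c)
  partial_fixpoint

end

/-- Contracts the β-redex at `term` whose function is an abstraction with body `t₁` and whose
argument is `t₂`. -/
def betaContract (h : Heap C V) (term t₁ t₂ : Ref) : Option (Heap C V) := do
  match ← h[t₁]? with
  | .susp t₃ ol nl (.dum nl₁ :: e) =>
    if nl = nl₁ + 1 then some (h.set term (.susp t₃ ol nl₁ (.bndg t₂ nl₁ :: e)))
    else some (h.set term (.susp t₁ 1 0 [.bndg t₂ 0]))
  | _ => some (h.set term (.susp t₁ 1 0 [.bndg t₂ 0]))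

/-- Reduces `term` to a weak head normal form (if `whnf` is true) or to a head normal form. -/
def hnEx (h : Heap C V) (term : Ref) (whnf : Bool) : Option (Heap C V) := do
  match ← h[term]? with
  | .app t₁ t₂ =>
    let h₁ ← hnEx h t₁ true
    let f ← deref h₁ t₁
    match ← h₁[f]? with
    | .lam t =>
      let h₂ ← betaContract h₁ term t t₂
      hnEx h₂ term whnf
    | _ => some h₁
  | .lam t => if whnf then some h else hnEx h t false
  | .susp _ _ _ _ =>
    let h₁ ← lazyRead h term
    hnEx h₁ term whnf
  | .ptr t =>
    let h₁ ← hnEx h t whnf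
    assign h₁ term t
  | _ => some h
  partial_fixpoint

/-- The head normalization procedure with explicit suspensions. -/
def headNorm2 (h : Heap C V) (t : Ref) : Option (Heap C V) := hnEx h t false

end Heap

end SuspNotation

/-!
A well-formed suspension term `t` stands for a de Bruijn term `t.toDB`, in which each suspension is
carried out as a simultaneous substitution. Reading rules leave `toDB` unchanged
(`Reads.wf_toDB`), so that the term `d` to which `t` can be read is `t.toDB`, and a rewriting step
with (βₛ) or (β'ₛ) is a parallel `β`-reduction of it (`BetaRule.par`); it is a contraction of the
head redex if the procedure contracts at the node that it is normalizing (`BetaRule.toDB_eq`).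

On de Bruijn terms, head reduction reaches a head normal form whenever there is one
(`DB.HasHNF.hNorm`); this is standardization, proved with the relation `DB.Std` of standard
reductions. Since nodes are shared, work at one node also reduces copies elsewhere in a term.
This does no harm: a parallel reduction step cannot make head reduction longer (`DB.HNorm.par`).

On the heap, the graph below a reference that represents a term is acyclic
(`Represents.acyclic`). Hence an assignment that applies a rule at one node rewrites the terms of all
references that share it and affects only nodes from which it can be reached; `Evolves` collects
these properties, which compose.

Lazy reading terminates because each of its steps lowers `STerm.readCost`, which no reading step
anywhere in a term can raise (`lazyReadAuxSpec`). The recursion of `hnEx` terminates by the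
lexicographic order on three numbers: the number of head reduction steps that `t.toDB` still needs,
which a contraction lowers; the size of `t.toDB`, which is smaller for the operator of an application
and the body of an abstraction; and the reading cost, which `lazyRead` lowers while it leaves
`t.toDB` unchanged (`hnExSpec`).
-/

namespace SuspNotation

open Relation

/-! ### Renumbering and substitution -/

namespace DB

variable {C V : Type}

/-- The substitution that `subst` uses under an abstraction. -/
def lift (s : ℕ → DB C V) : ℕ → DB C V :=
  fun n => Nat.casesOn n (bvar 0) fun k => (s k).rename Nat.succ

/-- The substitution `t, #1, #2, …` of a `β`-contraction. -/
def inst (t : DB C V) : ℕ → DB C V :=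
  fun n => Nat.casesOn n t fun k => bvar k

theorem subst_lam (t : DB C V) (s : ℕ → DB C V) : (lam t).subst s = lam (t.subst (lift s)) := rfl

theorem lift_bvar (ρ : ℕ → ℕ) :
    lift (fun n => (bvar (ρ n) : DB C V)) =
      fun n => bvar (Nat.casesOn n 0 fun k => ρ k + 1 : ℕ) := by
  funext n; cases n <;> rfl

theorem subst_bvar (t : DB C V) : t.subst bvar = t := by
  induction t with
  | lam t ih =>
    have : lift (bvar : ℕ → DB C V) = bvar := by funext n; cases n <;> rfl
    rw [subst_lam, this, ih]
  | _ => simp_all [subst]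

theorem subst_rename (t : DB C V) :
    ∀ (ρ : ℕ → ℕ) (s : ℕ → DB C V), (t.rename ρ).subst s = t.subst fun n => s (ρ n) := by
  induction t with
  | lam t ih =>
    intro ρ s
    simp only [rename, subst, ih]
    congr 2; funext n; cases n <;> rfl
  | _ => intros; simp_all [subst, rename]

theorem rename_rename (t : DB C V) (ρ ρ' : ℕ → ℕ) :
    (t.rename ρ).rename ρ' = t.rename fun n => ρ' (ρ n) := by
  rw [rename_eq_subst, subst_rename, ← rename_eq_subst]

theorem rename_id (t : DB C V) : t.rename (fun n => n) = t := by
  rw [rename_eq_subst, subst_bvar]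

theorem rename_subst (t : DB C V) :
    ∀ (s : ℕ → DB C V) (ρ : ℕ → ℕ), (t.subst s).rename ρ = t.subst fun n => (s n).rename ρ := by
  induction t with
  | lam t ih =>
    intro s ρ
    simp only [rename, subst, ih]
    congr 2; funext n
    cases n with
    | zero => rfl
    | succ n => simp only [rename_rename]
  | _ => intros; simp_all [subst, rename]

theorem subst_subst (t : DB C V) :
    ∀ s s' : ℕ → DB C V, (t.subst s).subst s' = t.subst fun n => (s n).subst s' := by
  induction t with
  | lam t ih =>
    intro s s'
    simp only [subst, ih]
    congr 2; funext n
    cases n with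
    | zero => rfl
    | succ n => simp only [rename_subst, subst_rename]
  | _ => intros; simp_all [subst]

theorem rename_succ_subst_inst (t u : DB C V) : (t.rename Nat.succ).subst (inst u) = t := by
  rw [subst_rename]; exact subst_bvar t

theorem subst_inst_subst (t u : DB C V) (s : ℕ → DB C V) :
    (t.subst (inst u)).subst s = (t.subst (lift s)).subst (inst (u.subst s)) := by
  rw [subst_subst, subst_subst]
  congr 1; funext n
  cases n with
  | zero => rfl
  | succ n => exact (rename_succ_subst_inst _ _).symm

/-- A relation that is preserved by the constructors and by substitution. -/
structure Compatible (Q : DB C V → DB C V → Prop) : Prop where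
  refl (t : DB C V) : Q t t
  app {t₁ t₁' t₂ t₂' : DB C V} : Q t₁ t₁' → Q t₂ t₂' → Q (app t₁ t₂) (app t₁' t₂')
  lam {t t' : DB C V} : Q t t' → Q (lam t) (lam t')
  subst {t t' : DB C V} {s s' : ℕ → DB C V} :
    Q t t' → (∀ n, Q (s n) (s' n)) → Q (t.subst s) (t'.subst s')

theorem Compatible.rename {Q : DB C V → DB C V → Prop} (hQ : Compatible Q) {t t' : DB C V}
    (h : Q t t') (ρ : ℕ → ℕ) : Q (t.rename ρ) (t'.rename ρ) := by
  rw [rename_eq_subst, rename_eq_subst]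
  exact hQ.subst h fun n => hQ.refl _

theorem compatible_eq : Compatible (Eq : DB C V → DB C V → Prop) where
  refl _ := rfl
  app h₁ h₂ := by rw [h₁, h₂]
  lam h := by rw [h]
  subst h hs := by rw [h, funext hs]

/-! ### Parallel reduction -/

/-- Parallel reduction: the contraction of some of the redexes that are present. -/
inductive Par : DB C V → DB C V → Prop
  | const (c : C) : Par (const c) (const c)
  | fvar (x : V) : Par (fvar x) (fvar x)
  | bvar (n : ℕ) : Par (bvar n) (bvar n)
  | app {t₁ t₁' t₂ t₂' : DB C V} : Par t₁ t₁' → Par t₂ t₂' → Par (app t₁ t₂) (app t₁' t₂')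
  | lam {t t' : DB C V} : Par t t' → Par (lam t) (lam t')
  | beta {t t' u u' : DB C V} : Par t t' → Par u u' → Par (app (lam t) u) (t'.subst (inst u'))

theorem Par.refl (t : DB C V) : Par t t := by
  induction t with
  | const c => exact .const c
  | fvar x => exact .fvar x
  | bvar n => exact .bvar n
  | app _ _ h₁ h₂ => exact .app h₁ h₂
  | lam _ h => exact .lam h

theorem Par.rename {t t' : DB C V} (h : Par t t') :
    ∀ ρ : ℕ → ℕ, Par (t.rename ρ) (t'.rename ρ) := by
  induction h with
  | beta _ _ h₁ h₂ =>
    intro ρ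
    rw [rename_eq_subst (subst _ _), subst_inst_subst, lift_bvar, ← rename_eq_subst,
      ← rename_eq_subst]
    exact .beta (h₁ _) (h₂ _)
  | app _ _ h₁ h₂ => intro ρ; exact .app (h₁ _) (h₂ _)
  | lam _ h => intro ρ; exact .lam (h _)
  | _ => intro ρ; exact .refl _

theorem Par.subst {t t' : DB C V} (h : Par t t') :
    ∀ {s s' : ℕ → DB C V}, (∀ n, Par (s n) (s' n)) → Par (t.subst s) (t'.subst s') := by
  have hl : ∀ {s s' : ℕ → DB C V}, (∀ n, Par (s n) (s' n)) → ∀ n, Par (lift s n) (lift s' n) := by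
    intro s s' hs n
    cases n with
    | zero => exact .refl _
    | succ n => exact (hs n).rename _
  induction h with
  | bvar n => intro s s' hs; exact hs n
  | beta _ _ h₁ h₂ =>
    intro s s' hs
    rw [subst_inst_subst]
    exact .beta (h₁ (hl hs)) (h₂ hs)
  | app _ _ h₁ h₂ => intro s s' hs; exact .app (h₁ hs) (h₂ hs)
  | lam _ h => intro s s' hs; exact .lam (h (hl hs))
  | _ => intros; exact .refl _

theorem compatible_par : Compatible (Par : DB C V → DB C V → Prop) where
  refl := .refl
  app := .app
  lam := .lam
  subst h hs := h.subst hs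

theorem Neutral.par {t t' : DB C V} (ht : Neutral t) (h : Par t t') : Neutral t' := by
  induction ht generalizing t' with
  | const c => cases h; exact .const c
  | fvar x => cases h; exact .fvar x
  | bvar n => cases h; exact .bvar n
  | app u h₁ ih =>
    cases h with
    | app ha hb => exact .app _ (ih ha)
    | beta => cases h₁

/-! ### Head reduction -/

/-- Weak head reduction (if the flag is true) and head reduction (if it is false). -/
inductive HStep : Bool → DB C V → DB C V → Prop
  | beta (w : Bool) (t u : DB C V) : HStep w (app (lam t) u) (t.subst (inst u))
  | app (w : Bool) {t t' : DB C V} (u : DB C V) : HStep true t t' → HStep w (app t u) (app t' u)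
  | lam {t t' : DB C V} : HStep false t t' → HStep false (lam t) (lam t')

/-- Weak head normal forms (if the flag is true) and head normal forms (if it is false). -/
inductive NF : Bool → DB C V → Prop
  | neutral (w : Bool) {t : DB C V} : Neutral t → NF w t
  | weak (t : DB C V) : NF true (lam t)
  | lam {t : DB C V} : NF false t → NF false (lam t)

/-- `HNorm w n t` says that at most `n` steps of `HStep w` lead from `t` to a normal form. -/
inductive HNorm (w : Bool) : ℕ → DB C V → Prop
  | nf (n : ℕ) {t : DB C V} : NF w t → HNorm w n t
  | step {n : ℕ} {t t' : DB C V} : HStep w t t' → HNorm w n t' → HNorm w (n + 1) t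

theorem HNorm.succ {w : Bool} {n : ℕ} {t : DB C V} (h : HNorm w n t) : HNorm w (n + 1) t := by
  induction h with
  | nf n h => exact .nf _ h
  | step hs _ ih => exact .step hs ih

theorem HNorm.of_lam {n : ℕ} {t : DB C V} (h : HNorm false n (.lam t)) : HNorm false n t := by
  generalize hu : DB.lam t = u at h
  induction h generalizing t with
  | nf n h =>
    subst hu
    cases h with
    | neutral _ h => cases h
    | lam h => exact .nf _ h
  | step hs _ ih =>
    subst hu
    cases hs with
    | lam hs => exact .step hs (ih rfl)

theorem HNorm.of_app {w : Bool} {n : ℕ} {t u : DB C V} (h : HNorm w n (.app t u)) :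
    HNorm true n t := by
  generalize hv : DB.app t u = v at h
  induction h generalizing t with
  | nf n h =>
    subst hv
    cases h with
    | neutral _ h => cases h with | app _ h => exact .nf _ (.neutral _ h)
  | step hs _ ih =>
    subst hv
    cases hs with
    | beta => exact .nf _ (.weak _)
    | app _ _ hs => exact .step hs (ih rfl)

theorem HNorm.of_redex {w : Bool} {n : ℕ} {t u : DB C V} (h : HNorm w n (.app (.lam t) u)) :
    ∃ m < n, HNorm w m (t.subst (inst u)) := by
  cases h with
  | nf _ h =>
    cases h with
    | neutral _ h => cases h with | app _ h => cases h
  | step hs h =>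
    cases hs with
    | beta => exact ⟨_, Nat.lt_succ_self _, h⟩
    | app _ _ hs => cases hs

theorem NF.par {w : Bool} {t t' : DB C V} (ht : NF w t) (h : Par t t') : NF w t' := by
  induction ht generalizing t' with
  | neutral w h₁ => exact .neutral _ (h₁.par h)
  | weak t => cases h; exact .weak _
  | lam _ ih => cases h with | lam h => exact .lam (ih h)

/-- A parallel step either contracts the head redex or leaves a residual of it. -/
theorem HStep.par {w : Bool} {t u t' : DB C V} (hs : HStep w t u) (h : Par t t') :
    Par u t' ∨ ∃ u', HStep w t' u' ∧ Par u u' := by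
  induction hs generalizing t' with
  | beta w t u =>
    cases h with
    | app h₁ h₂ => cases h₁ with | lam h₁ => exact .inr ⟨_, .beta _ _ _, h₁.subst fun n => by
        cases n with
        | zero => exact h₂
        | succ n => exact .refl _⟩
    | beta h₁ h₂ => exact .inl (h₁.subst fun n => by
        cases n with
        | zero => exact h₂
        | succ n => exact .refl _)
  | app w u hs ih =>
    cases h with
    | app h₁ h₂ =>
      obtain h | ⟨v, hv, h⟩ := ih h₁
      · exact .inl (.app h h₂)
      · exact .inr ⟨_, .app _ _ hv, .app h h₂⟩
    | beta h₁ h₂ => cases hs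
  | lam hs ih =>
    cases h with
    | lam h =>
      obtain h | ⟨v, hv, h⟩ := ih h
      · exact .inl (.lam h)
      · exact .inr ⟨_, .lam hv, .lam h⟩

/-- Reductions anywhere in a term do not make its head reduction longer. -/
theorem HNorm.par {w : Bool} {n : ℕ} {t t' : DB C V} (ht : HNorm w n t) (h : Par t t') :
    HNorm w n t' := by
  induction ht generalizing t' with
  | nf n ht => exact .nf _ (ht.par h)
  | step hs _ ih =>
    obtain h | ⟨v, hv, h⟩ := hs.par h
    · exact (ih h).succ
    · exact .step hv (ih h)

/-! ### Head reduction reaches existing head normal forms -/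

theorem HStep.subst {t t' : DB C V} (h : HStep true t t') (s : ℕ → DB C V) :
    HStep true (t.subst s) (t'.subst s) := by
  generalize hw : true = w at h
  induction h with
  | beta w t u => rw [subst_inst_subst]; exact .beta _ _ _
  | app w u _ ih => subst hw; exact .app _ _ (ih rfl)
  | lam => cases hw

/-- Standard reductions: weak head steps, followed by standard reductions of the immediate
subterms. -/
inductive Std : DB C V → DB C V → Prop
  | const {t : DB C V} {c : C} : ReflTransGen (HStep true) t (const c) → Std t (const c)
  | fvar {t : DB C V} {x : V} : ReflTransGen (HStep true) t (fvar x) → Std t (fvar x)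
  | bvar {t : DB C V} {n : ℕ} : ReflTransGen (HStep true) t (bvar n) → Std t (bvar n)
  | app {t u₁ u₂ v₁ v₂ : DB C V} :
      ReflTransGen (HStep true) t (app u₁ u₂) → Std u₁ v₁ → Std u₂ v₂ → Std t (app v₁ v₂)
  | lam {t u v : DB C V} : ReflTransGen (HStep true) t (lam u) → Std u v → Std t (lam v)

theorem Std.refl (t : DB C V) : Std t t := by
  induction t with
  | const c => exact .const .refl
  | fvar x => exact .fvar .refl
  | bvar n => exact .bvar .refl
  | app _ _ h₁ h₂ => exact .app .refl h₁ h₂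
  | lam _ h => exact .lam .refl h

theorem Std.of_steps {t u v : DB C V} (h : ReflTransGen (HStep true) t u) (hs : Std u v) :
    Std t v := by
  cases hs with
  | const h' => exact .const (h.trans h')
  | fvar h' => exact .fvar (h.trans h')
  | bvar h' => exact .bvar (h.trans h')
  | app h' h₁ h₂ => exact .app (h.trans h') h₁ h₂
  | lam h' h₁ => exact .lam (h.trans h') h₁

theorem steps_subst {t t' : DB C V} (h : ReflTransGen (HStep true) t t') (s : ℕ → DB C V) :
    ReflTransGen (HStep true) (t.subst s) (t'.subst s) :=
  h.lift (fun t => t.subst s) fun _ _ h => h.subst s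

theorem steps_app (w : Bool) {t t' : DB C V} (h : ReflTransGen (HStep true) t t') (u : DB C V) :
    ReflTransGen (HStep w) (app t u) (app t' u) :=
  h.lift (fun t => app t u) fun _ _ h => .app _ _ h

theorem Std.rename {t t' : DB C V} (h : Std t t') :
    ∀ ρ : ℕ → ℕ, Std (t.rename ρ) (t'.rename ρ) := by
  have hr : ∀ {t t' : DB C V} (ρ : ℕ → ℕ), ReflTransGen (HStep true) t t' →
      ReflTransGen (HStep true) (t.rename ρ) (t'.rename ρ) := by
    intro t t' ρ h
    rw [rename_eq_subst, rename_eq_subst]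
    exact steps_subst h _
  induction h with
  | const h => intro ρ; exact .const (hr ρ h)
  | fvar h => intro ρ; exact .fvar (hr ρ h)
  | bvar h => intro ρ; exact .bvar (hr ρ h)
  | app h _ _ h₁ h₂ => intro ρ; exact .app (hr ρ h) (h₁ _) (h₂ _)
  | lam h _ h₁ => intro ρ; exact .lam (hr ρ h) (h₁ _)

theorem Std.subst {t t' : DB C V} (h : Std t t') :
    ∀ {s s' : ℕ → DB C V}, (∀ n, Std (s n) (s' n)) → Std (t.subst s) (t'.subst s') := by
  induction h with
  | const h => intro s s' hs; exact .const (steps_subst h s)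
  | fvar h => intro s s' hs; exact .fvar (steps_subst h s)
  | bvar h => intro s s' hs; exact .of_steps (steps_subst h s) (hs _)
  | app h _ _ h₁ h₂ => intro s s' hs; exact .app (steps_subst h s) (h₁ hs) (h₂ hs)
  | lam h _ h₁ =>
    intro s s' hs
    refine .lam (steps_subst h s) (h₁ fun n => ?_)
    cases n with
    | zero => exact .refl _
    | succ n => exact (hs n).rename _

theorem Std.beta {t u v : DB C V} (h : Std t u) (hb : Beta u v) : Std t v := by
  induction hb generalizing t with
  | beta u₁ u₂ =>
    cases h with
    | app h h₁ h₂ =>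
      cases h₁ with
      | lam h' h₁ =>
        refine .of_steps ((h.trans (steps_app _ h' _)).tail (.beta _ _ _)) (h₁.subst fun n => ?_)
        cases n with
        | zero => exact h₂
        | succ n => exact .refl _
  | appL u _ ih => cases h with | app h h₁ h₂ => exact .app h (ih h₁) h₂
  | appR u _ ih => cases h with | app h h₁ h₂ => exact .app h h₁ (ih h₂)
  | lam _ ih => cases h with | lam h h₁ => exact .lam h (ih h₁)

theorem Std.neutral {t u : DB C V} (h : Std t u) (hu : Neutral u) :
    ∃ v, ReflTransGen (HStep true) t v ∧ Neutral v := by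
  induction hu generalizing t with
  | const c => cases h with | const h => exact ⟨_, h, .const c⟩
  | fvar c => cases h with | fvar h => exact ⟨_, h, .fvar c⟩
  | bvar c => cases h with | bvar h => exact ⟨_, h, .bvar c⟩
  | app u _ ih =>
    cases h with
    | app h h₁ h₂ =>
      obtain ⟨v, hv, hn⟩ := ih h₁
      exact ⟨_, h.trans (steps_app _ hv _), .app _ hn⟩

theorem HStep.of_weak {w : Bool} {t t' : DB C V} (h : HStep true t t') : HStep w t t' := by
  cases h with
  | beta => exact .beta _ _ _
  | app _ _ h => exact .app _ _ h

theorem Std.hnf {t u : DB C V} (h : Std t u) (hu : HNF u) :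
    ∃ v, ReflTransGen (HStep false) t v ∧ NF false v := by
  induction hu generalizing t with
  | neutral hu =>
    obtain ⟨v, hv, hn⟩ := h.neutral hu
    exact ⟨v, hv.lift (fun t => t) fun _ _ => HStep.of_weak, .neutral _ hn⟩
  | lam _ ih =>
    cases h with
    | lam h h₁ =>
      obtain ⟨v, hv, hn⟩ := ih h₁
      exact ⟨DB.lam v,
        (h.lift (fun t => t) fun _ _ => HStep.of_weak).trans (hv.lift DB.lam fun _ _ => .lam),
        .lam hn⟩

/-- The standardization theorem for head normal forms. -/
theorem HasHNF.hNorm {t : DB C V} (h : t.HasHNF) : ∃ n, HNorm false n t := by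
  obtain ⟨u, hu, hn⟩ := h
  have hs : Std t u := by
    clear hn
    induction hu with
    | refl => exact .refl t
    | tail _ hb ih => exact ih.beta hb
  obtain ⟨v, hv, hn⟩ := hs.hnf hn
  clear hs hu
  induction hv using ReflTransGen.head_induction_on with
  | refl => exact ⟨0, .nf _ hn⟩
  | head h _ ih => exact ih.imp' _ fun n hn => .step h hn

end DB

/-! ### The de Bruijn term of a suspension term -/

variable {C V : Type}

mutual

/-- The de Bruijn term that a well-formed suspension term stands for. -/
def STerm.toDB : STerm C V → DB C V
  | .const c => .const c
  | .fvar x => .fvar x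
  | .bvar n => .bvar n
  | .app t₁ t₂ => .app t₁.toDB t₂.toDB
  | .lam t => .lam t.toDB
  | .susp t _ nl e => t.toDB.subst (e.toSubst nl)

/-- The substitution that an environment stands for at the embedding level `nl`. -/
def Env.toSubst : Env C V → ℕ → ℕ → DB C V
  | .nil, nl => fun n => .bvar (n + nl)
  | .cons et e, nl => fun n => Nat.casesOn n (et.toDB nl) (e.toSubst nl)

/-- The de Bruijn term that an environment item stands for at the embedding level `nl`. -/
def ETerm.toDB : ETerm C V → ℕ → DB C V
  | .dum l, nl => .bvar (nl - (l + 1))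
  | .bnd t l, nl => t.toDB.rename fun n => n + (nl - l)

end

theorem DB.toDB_toSTerm (d : DB C V) : d.toSTerm.toDB = d := by
  induction d <;> simp_all [DB.toSTerm, STerm.toDB]

theorem Env.toSubst_length_add (e : Env C V) (nl k : ℕ) :
    e.toSubst nl (e.length + k) = .bvar (k + nl) := by
  match e with
  | .nil => simp [Env.toSubst, Env.length]
  | .cons et e =>
    rw [Env.length, Nat.add_right_comm]
    simpa [Env.toSubst] using Env.toSubst_length_add e nl k

theorem Env.toSubst_of_get? {e : Env C V} {n : ℕ} {et : ETerm C V} (nl : ℕ)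
    (h : e.get? n = some et) : e.toSubst nl n = et.toDB nl := by
  match e, n, h with
  | .cons _ _, 0, h => simp only [Env.get?, Option.some.injEq] at h; subst h; rfl
  | .cons _ e, n + 1, h => exact Env.toSubst_of_get? (e := e) nl h

theorem Env.exists_get? {e : Env C V} {n : ℕ} (h : n < e.length) : ∃ et, e.get? n = some et := by
  match e, n, h with
  | .nil, _, h => cases h
  | .cons et _, 0, _ => exact ⟨et, rfl⟩
  | .cons _ e, n + 1, h => exact Env.exists_get? (e := e) (Nat.lt_of_succ_lt_succ h)

theorem Env.Fits.mono {e : Env C V} {nl nl' : ℕ} (h : e.Fits nl) (hl : nl ≤ nl') :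
    e.Fits nl' := by
  match e, h with
  | .nil, _ => trivial
  | .cons (.dum _) e, h => exact ⟨h.1.trans_le hl, Env.Fits.mono (e := e) h.2 hl⟩
  | .cons (.bnd _ _) e, h => exact ⟨h.1.trans hl, Env.Fits.mono (e := e) h.2 hl⟩

theorem Env.Fits.lt_of_get? {e : Env C V} {nl n l : ℕ} (h : e.Fits nl)
    (hn : e.get? n = some (.dum l)) : l < nl := by
  match e, n, h, hn with
  | .cons _ _, 0, h, hn => simp only [Env.get?, Option.some.injEq] at hn; subst hn; exact h.1
  | .cons (.dum _) e, n + 1, h, hn => exact Env.Fits.lt_of_get? (e := e) h.2 hn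
  | .cons (.bnd _ _) e, n + 1, h, hn => exact Env.Fits.lt_of_get? (e := e) h.2 hn

theorem Env.Fits.le_of_get? {e : Env C V} {nl n l : ℕ} {t : STerm C V} (h : e.Fits nl)
    (hn : e.get? n = some (.bnd t l)) : l ≤ nl := by
  match e, n, h, hn with
  | .cons _ _, 0, h, hn => simp only [Env.get?, Option.some.injEq] at hn; subst hn; exact h.1
  | .cons (.dum _) e, n + 1, h, hn => exact Env.Fits.le_of_get? (e := e) h.2 hn
  | .cons (.bnd _ _) e, n + 1, h, hn => exact Env.Fits.le_of_get? (e := e) h.2 hn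

theorem Env.WF.of_get? {e : Env C V} {n : ℕ} {et : ETerm C V} (h : e.WF)
    (hn : e.get? n = some et) : et.WF := by
  match e, n, h, hn with
  | .cons _ _, 0, h, hn =>
    simp only [Env.get?, Option.some.injEq] at hn; subst hn; simp only [Env.WF] at h; exact h.1
  | .cons _ e, n + 1, h, hn =>
    simp only [Env.WF] at h; exact Env.WF.of_get? (e := e) h.2 hn

/-- Raising the embedding level renumbers the terms of an environment that fits. -/
theorem Env.Fits.toSubst_add {e : Env C V} {nl : ℕ} (h : e.Fits nl) (j n : ℕ) :
    e.toSubst (nl + j) n = (e.toSubst nl n).rename fun k => k + j := by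
  match e, n, h with
  | .nil, n, _ => simp [Env.toSubst, DB.rename, Nat.add_assoc]
  | .cons (.dum l) e, 0, h =>
    have : l < nl := h.1
    simp only [Env.toSubst]
    change (ETerm.dum l).toDB _ = ((ETerm.dum l).toDB _).rename _
    simp only [ETerm.toDB, DB.rename]
    congr 1; omega
  | .cons (.bnd t l) e, 0, h =>
    have : l ≤ nl := h.1
    simp only [Env.toSubst]
    change (ETerm.bnd t l).toDB _ = ((ETerm.bnd t l).toDB _).rename _
    simp only [ETerm.toDB, DB.rename_rename]
    congr 1; funext k; omega
  | .cons (.dum _) e, n + 1, h => exact Env.Fits.toSubst_add (e := e) h.2 j n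
  | .cons (.bnd _ _) e, n + 1, h => exact Env.Fits.toSubst_add (e := e) h.2 j n

theorem Env.Fits.lift_toSubst {e : Env C V} {nl : ℕ} (h : e.Fits nl) :
    DB.lift (e.toSubst nl) = (Env.cons (.dum nl) e).toSubst (nl + 1) := by
  funext n
  cases n with
  | zero => simp [DB.lift, Env.toSubst, ETerm.toDB]
  | succ n => exact (h.toSubst_add 1 n).symm

theorem STerm.toDB_susp_nil (t : STerm C V) (j : ℕ) :
    (STerm.susp t 0 j .nil).toDB = t.toDB.rename fun n => n + j := by
  rw [DB.rename_eq_subst]; simp only [STerm.toDB, Env.toSubst]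

theorem STerm.WF.susp_add {t : STerm C V} {ol nl : ℕ} {e : Env C V}
    (h : (STerm.susp t ol nl e).WF) (j : ℕ) : (STerm.susp t ol (nl + j) e).WF := by
  simp only [STerm.WF] at h ⊢
  obtain ⟨h₁, h₂, h₃, h₄, h₅⟩ := h
  refine ⟨h₁, h₂, h₃, h₄.mono (Nat.le_add_right _ _), ?_⟩
  intro l e' he hl
  subst he
  have : l < nl := h₄.1
  exact h₅ l e' rfl (by omega)

theorem STerm.WF.susp_nil {t : STerm C V} (h : t.WF) (j : ℕ) :
    (STerm.susp t 0 j .nil).WF := by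
  simp [STerm.WF, Env.WF, Env.length, Env.Fits, h]

theorem STerm.toDB_susp_add {t : STerm C V} {ol nl : ℕ} {e : Env C V} (h : e.Fits nl) (j : ℕ) :
    (STerm.susp t ol (nl + j) e).toDB = (STerm.susp t ol nl e).toDB.rename fun n => n + j := by
  simp only [STerm.toDB, DB.rename_subst]
  congr 1; funext n; exact h.toSubst_add j n

theorem ReadingRule.wf {t t' : STerm C V} (h : ReadingRule t t') (ht : t.WF) : t'.WF := by
  cases h with
  | r1 | r2 | r3 | r4 => simp only [STerm.WF]
  | r5 n ol nl l j e t hn he hj =>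
    simp only [STerm.WF] at ht
    have := ht.2.1.of_get? he
    simp only [ETerm.WF] at this
    exact this.susp_nil j
  | r6 => simp_all [STerm.WF]
  | r7 t ol nl e =>
    simp only [STerm.WF, Env.WF, ETerm.WF] at ht ⊢
    obtain ⟨h₁, h₂, h₃, h₄, h₅⟩ := ht
    refine ⟨h₁, ⟨trivial, h₂⟩, by rw [Env.length, h₃], ⟨Nat.lt_succ_self _, h₄.mono (by omega)⟩, ?_⟩
    rintro l e' he hl
    cases he
    exact h₄
  | r8 t ol nl nl' e =>
    rw [STerm.WF] at ht
    exact ht.1.susp_add nl'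
  | r9 => rw [STerm.WF] at ht; exact ht.1
  | r10 n ol nl e t hn he =>
    simp only [STerm.WF] at ht
    have := ht.2.1.of_get? he
    simpa only [ETerm.WF] using this
  | r11 n ol nl l j ol' nl' e e' t hn he hj hne =>
    rw [STerm.WF] at ht
    have := ht.2.1.of_get? he
    rw [ETerm.WF] at this
    exact this.susp_add j
  | r12 n ol nl l j e t hn he hj hne hns =>
    rw [STerm.WF] at ht
    have := ht.2.1.of_get? he
    rw [ETerm.WF] at this
    exact this.susp_nil j

theorem ReadingRule.toDB_eq {t t' : STerm C V} (h : ReadingRule t t') (ht : t.WF) :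
    t.toDB = t'.toDB := by
  cases h with
  | r1 | r2 | r6 => simp only [STerm.toDB, DB.subst]
  | r3 k ol nl e =>
    simp only [STerm.WF] at ht
    simp only [STerm.toDB, DB.subst]
    rw [← ht.2.2.1, e.toSubst_length_add]
  | r4 n ol nl l m e hn he hm =>
    simp only [STerm.toDB, DB.subst]
    rw [Env.toSubst_of_get? _ he, ETerm.toDB, hm]
    congr 1; omega
  | r5 n ol nl l j e t hn he hj =>
    rw [STerm.toDB_susp_nil]
    simp only [STerm.toDB, DB.subst]
    rw [Env.toSubst_of_get? _ he, ETerm.toDB, hj, Nat.add_sub_cancel_left]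
  | r7 t ol nl e =>
    rw [STerm.WF] at ht
    simp only [STerm.toDB, DB.subst_lam, ht.2.2.2.1.lift_toSubst]
  | r8 t ol nl nl' e =>
    rw [STerm.WF, STerm.WF] at ht
    rw [STerm.toDB_susp_nil, STerm.toDB_susp_add ht.1.2.2.2.1]
  | r9 => rw [STerm.toDB_susp_nil]; exact DB.rename_id _
  | r10 n ol nl e t hn he =>
    simp only [STerm.toDB, DB.subst]
    rw [Env.toSubst_of_get? _ he, ETerm.toDB, Nat.sub_self]
    exact DB.rename_id _
  | r11 n ol nl l j ol' nl' e e' t hn he hj hne =>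
    rw [STerm.WF] at ht
    have := ht.2.1.of_get? he
    rw [ETerm.WF, STerm.WF] at this
    rw [STerm.toDB_susp_add this.2.2.2.1]
    simp only [STerm.toDB, DB.subst]
    rw [Env.toSubst_of_get? _ he, ETerm.toDB, hj, Nat.add_sub_cancel_left, STerm.toDB]
  | r12 n ol nl l j e t hn he hj hne ht =>
    rw [STerm.toDB_susp_nil]
    simp only [STerm.toDB, DB.subst]
    rw [Env.toSubst_of_get? _ he, ETerm.toDB, hj, Nat.add_sub_cancel_left]

theorem BetaRule.wf {t t' : STerm C V} (h : BetaRule t t') (ht : t.WF) : t'.WF := by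
  cases h with
  | beta => simp_all [STerm.WF, Env.WF, ETerm.WF, Env.length, Env.Fits]
  | beta' t₁ t₂ ol nl e =>
    simp only [STerm.WF, Env.WF, ETerm.WF, Env.length] at ht ⊢
    obtain ⟨⟨h₁, h₂, h₃, h₄, h₅⟩, h₆⟩ := ht
    refine ⟨h₁, ⟨h₆, h₂.2⟩, h₃, ⟨le_rfl, h₅ nl e rfl rfl⟩, ?_⟩
    intro l e' he
    cases he

/-- The rules (βₛ) and (β'ₛ) perform the `β`-contraction of the redex at the root. -/
theorem BetaRule.toDB_eq {t t' : STerm C V} (h : BetaRule t t') (ht : t.WF) :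
    ∃ t₁ t₂ : STerm C V, t = .app (.lam t₁) t₂ ∧
      t'.toDB = t₁.toDB.subst (DB.inst t₂.toDB) := by
  cases h with
  | beta t₁ t₂ =>
    refine ⟨t₁, t₂, rfl, ?_⟩
    simp only [STerm.toDB]
    congr 1; funext n
    cases n with
    | zero => exact DB.rename_id _
    | succ n => rfl
  | beta' t₁ t₂ ol nl e =>
    refine ⟨_, t₂, rfl, ?_⟩
    simp only [STerm.WF] at ht
    simp only [STerm.toDB, DB.subst_subst]
    congr 1; funext n
    cases n with
    | zero =>
      simp only [Env.toSubst, ETerm.toDB, Nat.sub_self]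
      exact DB.rename_id _
    | succ n =>
      have := (ht.1.2.2.2.2 nl e rfl rfl).toSubst_add 1 n
      simp only [Env.toSubst, this]
      exact (DB.rename_succ_subst_inst _ _).symm

theorem BetaRule.par {t t' : STerm C V} (h : BetaRule t t') (ht : t.WF) :
    DB.Par t.toDB t'.toDB := by
  obtain ⟨t₁, t₂, rfl, hb⟩ := h.toDB_eq ht
  rw [hb]
  simp only [STerm.toDB]
  exact .beta (.refl _) (.refl _)

section Steps

variable {R : STerm C V → STerm C V → Prop}

theorem EnvStep.length_eq {e e' : Env C V} (h : EnvStep R e e') : e'.length = e.length := by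
  match h with
  | .head _ _ _ => rfl
  | .tail _ h => simp only [Env.length, EnvStep.length_eq h]

theorem EnvStep.fits {e e' : Env C V} (h : EnvStep R e e') {nl : ℕ} (he : e.Fits nl) :
    e'.Fits nl := by
  match h with
  | .head _ _ _ => exact he
  | .tail (.dum _) h => exact ⟨he.1, EnvStep.fits h he.2⟩
  | .tail (.bnd _ _) h => exact ⟨he.1, EnvStep.fits h he.2⟩

variable {Q : DB C V → DB C V → Prop}

mutual

/-- If the rules of `R` preserve well-formedness and act by `Q` on the de Bruijn terms, then so do
the steps by these rules at subterms. -/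
theorem TermStep.wf_toDB (hQ : DB.Compatible Q)
    (hR : ∀ t t', R t t' → t.WF → t'.WF ∧ Q t.toDB t'.toDB) {t t' : STerm C V}
    (h : TermStep R t t') (ht : t.WF) : t'.WF ∧ Q t.toDB t'.toDB := by
  match h with
  | .root h => exact hR _ _ h ht
  | .appL t₂ h =>
    rw [STerm.WF] at ht
    have ih := TermStep.wf_toDB hQ hR h ht.1
    simp only [STerm.WF, STerm.toDB]
    exact ⟨⟨ih.1, ht.2⟩, hQ.app ih.2 (hQ.refl _)⟩
  | .appR t₁ h =>
    rw [STerm.WF] at ht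
    have ih := TermStep.wf_toDB hQ hR h ht.2
    simp only [STerm.WF, STerm.toDB]
    exact ⟨⟨ht.1, ih.1⟩, hQ.app (hQ.refl _) ih.2⟩
  | .lam h =>
    rw [STerm.WF] at ht
    have ih := TermStep.wf_toDB hQ hR h ht
    simp only [STerm.WF, STerm.toDB]
    exact ⟨ih.1, hQ.lam ih.2⟩
  | .suspT ol nl e h =>
    rw [STerm.WF] at ht
    have ih := TermStep.wf_toDB hQ hR h ht.1
    simp only [STerm.WF, STerm.toDB]
    exact ⟨⟨ih.1, ht.2⟩, hQ.subst ih.2 fun _ => hQ.refl _⟩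
  | .suspE t ol nl h =>
    rw [STerm.WF] at ht
    obtain ⟨h₁, h₂, h₃, h₄, h₅⟩ := ht
    have ih := EnvStep.wf_toSubst hQ hR h h₂
    simp only [STerm.WF, STerm.toDB]
    refine ⟨⟨h₁, ih.1, h.length_eq.trans h₃, h.fits h₄, ?_⟩, hQ.subst (hQ.refl _) (ih.2 nl)⟩
    rintro l e' rfl hl
    match h with
    | .tail _ h => exact h.fits (h₅ _ _ rfl hl)

theorem EnvStep.wf_toSubst (hQ : DB.Compatible Q)
    (hR : ∀ t t', R t t' → t.WF → t'.WF ∧ Q t.toDB t'.toDB) {e e' : Env C V}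
    (h : EnvStep R e e') (he : e.WF) :
    e'.WF ∧ ∀ nl n, Q (e.toSubst nl n) (e'.toSubst nl n) := by
  match h with
  | .head l e h =>
    rw [Env.WF, ETerm.WF] at he
    have ih := TermStep.wf_toDB hQ hR h he.1
    rw [Env.WF, ETerm.WF]
    refine ⟨⟨ih.1, he.2⟩, fun nl n => ?_⟩
    cases n with
    | zero => simp only [Env.toSubst, ETerm.toDB]; exact hQ.rename ih.2 _
    | succ n => exact hQ.refl _
  | .tail et h =>
    rw [Env.WF] at he
    have ih := EnvStep.wf_toSubst hQ hR h he.2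
    rw [Env.WF]
    refine ⟨⟨he.1, ih.1⟩, fun nl n => ?_⟩
    cases n with
    | zero => exact hQ.refl _
    | succ n => exact ih.2 nl n

end

end Steps

theorem Reads.wf_toDB {t t' : STerm C V} (h : Reads t t') (ht : t.WF) :
    t'.WF ∧ t.toDB = t'.toDB := by
  induction h with
  | refl => exact ⟨ht, rfl⟩
  | tail _ hs ih =>
    have := hs.wf_toDB DB.compatible_eq (fun _ _ h ht => ⟨h.wf ht, h.toDB_eq ht⟩) ih.1
    exact ⟨this.1, ih.2.trans this.2⟩

theorem Rewrites.wf_hNorm {t t' : STerm C V} (h : Rewrites t t') (ht : t.WF) :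
    t'.WF ∧ ∀ w n, DB.HNorm w n t.toDB → DB.HNorm w n t'.toDB := by
  induction h with
  | refl => exact ⟨ht, fun _ _ h => h⟩
  | tail _ hs ih =>
    have := hs.wf_toDB DB.compatible_par (fun _ _ h ht => h.elim
      (fun h => ⟨h.wf ht, h.toDB_eq ht ▸ .refl _⟩) fun h => ⟨h.wf ht, h.par ht⟩) ih.1
    exact ⟨this.1, fun w n hn => (ih.2 w n hn).par this.2⟩

mutual

theorem TermStep.mono {R R' : STerm C V → STerm C V → Prop} (hR : ∀ t t', R t t' → R' t t')
    {t t' : STerm C V} (h : TermStep R t t') : TermStep R' t t' := by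
  match h with
  | .root h => exact .root (hR _ _ h)
  | .appL _ h => exact .appL _ (TermStep.mono hR h)
  | .appR _ h => exact .appR _ (TermStep.mono hR h)
  | .lam h => exact .lam (TermStep.mono hR h)
  | .suspT _ _ _ h => exact .suspT _ _ _ (TermStep.mono hR h)
  | .suspE _ _ _ h => exact .suspE _ _ _ (EnvStep.mono hR h)

theorem EnvStep.mono {R R' : STerm C V → STerm C V → Prop} (hR : ∀ t t', R t t' → R' t t')
    {e e' : Env C V} (h : EnvStep R e e') : EnvStep R' e e' := by
  match h with
  | .head _ _ h => exact .head _ _ (TermStep.mono hR h)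
  | .tail _ h => exact .tail _ (EnvStep.mono hR h)

end

theorem Reads.rewrites {t t' : STerm C V} (h : Reads t t') : Rewrites t t' :=
  h.lift (fun t => t) fun _ _ h => h.mono fun _ _ => Or.inl

/-! ### The cost of exposing the top-level structure of a term -/

mutual

/-- A bound on the number of reading steps that expose the top-level structure of a term. Terms
under an application or an abstraction are not looked at. A variable reference costs `1`, because
reading it in a suspension may yield a suspension `⟦t, 0, nl - l, nil⟧` again, where `(t, l)` is an
item of the environment, and the cost has to decrease even in this case. -/
def STerm.readCost : STerm C V → ℕ
  | .const _ => 0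
  | .fvar _ => 0
  | .bvar _ => 1
  | .app _ _ => 0
  | .lam _ => 0
  | .susp t _ _ e => t.readCost + e.readCost + 1

/-- The sum of the costs of the terms in the environment. -/
def Env.readCost : Env C V → ℕ
  | .nil => 0
  | .cons et e => et.readCost + e.readCost

/-- The cost of the term in the environment item, if there is one. -/
def ETerm.readCost : ETerm C V → ℕ
  | .dum _ => 0
  | .bnd t _ => t.readCost

end

theorem Env.readCost_le_of_get? {e : Env C V} {n : ℕ} {et : ETerm C V}
    (h : e.get? n = some et) : et.readCost ≤ e.readCost := by
  match e, n, h with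
  | .cons _ _, 0, h =>
    simp only [Env.get?, Option.some.injEq] at h
    subst h; rw [Env.readCost]; exact Nat.le_add_right _ _
  | .cons et' e, n + 1, h =>
    have := Env.readCost_le_of_get? (e := e) h
    rw [Env.readCost]; omega

theorem ReadingRule.readCost_le {t t' : STerm C V} (h : ReadingRule t t') :
    t'.readCost ≤ t.readCost := by
  cases h with
  | r5 _ _ _ _ _ _ _ _ he | r10 _ _ _ _ _ _ he | r11 _ _ _ _ _ _ _ _ _ _ _ he
  | r12 _ _ _ _ _ _ _ _ he =>
    have := Env.readCost_le_of_get? he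
    simp only [STerm.readCost, ETerm.readCost, Env.readCost] at this ⊢
    omega
  | _ => simp only [STerm.readCost, Env.readCost]; omega

mutual

theorem TermStep.readCost_le {t t' : STerm C V} (h : TermStep ReadingRule t t') :
    t'.readCost ≤ t.readCost := by
  match h with
  | .root h => exact h.readCost_le
  | .appL _ _ | .appR _ _ | .lam _ => simp only [STerm.readCost]; exact le_rfl
  | .suspT _ _ _ h =>
    have := TermStep.readCost_le h
    simp only [STerm.readCost]; omega
  | .suspE _ _ _ h =>
    have := EnvStep.readCost_le h
    simp only [STerm.readCost]; omega

theorem EnvStep.readCost_le {e e' : Env C V} (h : EnvStep ReadingRule e e') :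
    e'.readCost ≤ e.readCost := by
  match h with
  | .head _ _ h =>
    have := TermStep.readCost_le h
    simp only [Env.readCost, ETerm.readCost]; omega
  | .tail _ h =>
    have := EnvStep.readCost_le h
    simp only [Env.readCost]; omega

end

theorem Reads.readCost_le {t t' : STerm C V} (h : Reads t t') : t'.readCost ≤ t.readCost := by
  induction h with
  | refl => exact le_rfl
  | tail _ hs ih => exact hs.readCost_le.trans ih

/-! ### Reachability and acyclicity on the heap -/

/-- The reference occurs in the cell. -/
def RawTerm.Mentions : RawTerm C V → Ref → Prop
  | .const _, _ => False
  | .fv _, _ => False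
  | .bv _, _ => False
  | .ptr t, r => r = t
  | .lam t, r => r = t
  | .app t₁ t₂, r => r = t₁ ∨ r = t₂
  | .susp t _ _ env, r => r = t ∨ ∃ l, EItem.bndg r l ∈ env

/-- The reference `b` occurs in the cell at `a`. -/
def Child (h : Heap C V) (a b : Ref) : Prop := ∃ v, h[a]? = some v ∧ v.Mentions b

/-- The reference `b` can be reached from `a`. -/
def Reach (h : Heap C V) : Ref → Ref → Prop := ReflTransGen (Child h)

/-- The reference `b` can be reached from `a` in at least one step. -/
def Below (h : Heap C V) : Ref → Ref → Prop := TransGen (Child h)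

/-- The reference `b` can be reached from `a` along indirections. -/
def PtrPath (h : Heap C V) : Ref → Ref → Prop :=
  ReflTransGen fun a b => h[a]? = some (RawTerm.ptr b)

theorem Below.reach {h : Heap C V} {a b : Ref} (hab : Below h a b) : Reach h a b :=
  TransGen.to_reflTransGen hab

theorem PtrPath.reach {h : Heap C V} {a b : Ref} (hab : PtrPath h a b) : Reach h a b := by
  induction hab with
  | refl => exact .refl
  | tail _ hx ih => exact .tail ih ⟨_, hx, rfl⟩

theorem Child.ptr {h : Heap C V} {a b : Ref} (ha : h[a]? = some (.ptr b)) : Child h a b :=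
  ⟨_, ha, rfl⟩

theorem Child.lam {h : Heap C V} {a b : Ref} (ha : h[a]? = some (.lam b)) : Child h a b :=
  ⟨_, ha, rfl⟩

theorem Child.appL {h : Heap C V} {a b c : Ref} (ha : h[a]? = some (.app b c)) : Child h a b :=
  ⟨_, ha, .inl rfl⟩

theorem Child.appR {h : Heap C V} {a b c : Ref} (ha : h[a]? = some (.app b c)) : Child h a c :=
  ⟨_, ha, .inr rfl⟩

theorem Child.susp {h : Heap C V} {a b : Ref} {ol nl : ℤ} {env : List EItem}
    (ha : h[a]? = some (.susp b ol nl env)) : Child h a b :=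
  ⟨_, ha, .inl rfl⟩

theorem Child.env {h : Heap C V} {a b c : Ref} {ol nl l : ℤ} {env : List EItem}
    (ha : h[a]? = some (.susp b ol nl env)) (hc : EItem.bndg c l ∈ env) : Child h a c :=
  ⟨_, ha, .inr ⟨l, hc⟩⟩

theorem lt_length {h : Heap C V} {a : Ref} {v : RawTerm C V} (ha : h[a]? = some v) :
    a < h.length :=
  (List.getElem?_eq_some_iff.1 ha).1

section Inversion

variable {h : Heap C V} {r : Ref} {t : STerm C V}

theorem Represents.ptr_inv (hr : Represents h r t) {a : Ref} (ha : h[r]? = some (.ptr a)) :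
    Represents h a t := by
  cases hr <;> simp_all

theorem Represents.const_inv (hr : Represents h r t) {c : C} (ha : h[r]? = some (.const c)) :
    t = .const c := by
  cases hr <;> simp_all

theorem Represents.fv_inv (hr : Represents h r t) {x : V} (ha : h[r]? = some (.fv x)) :
    t = .fvar x := by
  cases hr <;> simp_all

theorem Represents.bv_inv (hr : Represents h r t) {i : ℤ} (ha : h[r]? = some (.bv i)) :
    ∃ n : ℕ, i = n + 1 ∧ t = .bvar n := by
  cases hr <;> simp_all

theorem Represents.lam_inv (hr : Represents h r t) {a : Ref} (ha : h[r]? = some (.lam a)) :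
    ∃ s, t = .lam s ∧ Represents h a s := by
  cases hr <;> simp_all

theorem Represents.app_inv (hr : Represents h r t) {a b : Ref} (ha : h[r]? = some (.app a b)) :
    ∃ s₁ s₂, t = .app s₁ s₂ ∧ Represents h a s₁ ∧ Represents h b s₂ := by
  cases hr <;> simp_all

theorem Represents.susp_inv (hr : Represents h r t) {a : Ref} {ol nl : ℤ} {env : List EItem}
    (ha : h[r]? = some (.susp a ol nl env)) :
    ∃ (s : STerm C V) (m n : ℕ) (e : Env C V), ol = m ∧ nl = n ∧ t = .susp s m n e ∧
      Represents h a s ∧ RepresentsEnv h env e := by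
  cases hr with
  | susp hr ht he =>
    rw [hr] at ha
    cases ha
    exact ⟨_, _, _, _, rfl, rfl, rfl, ht, he⟩
  | _ => simp_all

end Inversion

theorem RepresentsEnv.exists_of_mem {h : Heap C V} {env : List EItem} {e : Env C V}
    (he : RepresentsEnv h env e) {r : Ref} {l : ℤ} (hr : EItem.bndg r l ∈ env) :
    ∃ t, Represents h r t := by
  match he with
  | .nil => cases hr
  | .dum he => exact RepresentsEnv.exists_of_mem he (by simpa using hr)
  | .bndg ht he =>
    rcases List.mem_cons.1 hr with hr | hr
    · cases hr; exact ⟨_, ht⟩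
    · exact RepresentsEnv.exists_of_mem he hr

theorem Represents.exists_cell {h : Heap C V} {r : Ref} {t : STerm C V} (hr : Represents h r t) :
    ∃ v, h[r]? = some v := by
  cases hr <;> exact ⟨_, ‹_›⟩

theorem Represents.lt_length {h : Heap C V} {r : Ref} {t : STerm C V} (hr : Represents h r t) :
    r < h.length :=
  SuspNotation.lt_length hr.exists_cell.choose_spec

theorem Represents.child {h : Heap C V} {a b : Ref} {t : STerm C V} (ha : Represents h a t)
    (hb : Child h a b) : ∃ s, Represents h b s := by
  obtain ⟨v, hv, hm⟩ := hb
  cases v with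
  | const | fv | bv => cases hm
  | ptr c => cases hm; exact ⟨_, ha.ptr_inv hv⟩
  | lam c => cases hm; obtain ⟨_, -, h⟩ := ha.lam_inv hv; exact ⟨_, h⟩
  | app c d =>
    obtain ⟨_, _, -, h₁, h₂⟩ := ha.app_inv hv
    rcases hm with rfl | rfl
    exacts [⟨_, h₁⟩, ⟨_, h₂⟩]
  | susp c ol nl env =>
    obtain ⟨_, _, _, _, -, -, -, h₁, h₂⟩ := ha.susp_inv hv
    rcases hm with rfl | ⟨l, hm⟩
    exacts [⟨_, h₁⟩, h₂.exists_of_mem hm]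

theorem Represents.reach {h : Heap C V} {a b : Ref} {t : STerm C V} (ha : Represents h a t)
    (hab : Reach h a b) : ∃ s, Represents h b s := by
  induction hab with
  | refl => exact ⟨_, ha⟩
  | tail _ hc ih => exact ih.choose_spec.child hc

mutual

theorem Represents.unique {h : Heap C V} {r : Ref} {t t' : STerm C V} (hr : Represents h r t)
    (hr' : Represents h r t') : t = t' := by
  match hr with
  | .const ha => exact (hr'.const_inv ha).symm
  | .fv ha => exact (hr'.fv_inv ha).symm
  | .bv ha => obtain ⟨n, hn, rfl⟩ := hr'.bv_inv ha; congr 1; omega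
  | .ptr ha ht => exact Represents.unique ht (hr'.ptr_inv ha)
  | .lam ha ht =>
    obtain ⟨s, rfl, hs⟩ := hr'.lam_inv ha
    rw [Represents.unique ht hs]
  | .app ha h₁ h₂ =>
    obtain ⟨s₁, s₂, rfl, hs₁, hs₂⟩ := hr'.app_inv ha
    rw [Represents.unique h₁ hs₁, Represents.unique h₂ hs₂]
  | .susp ha ht he =>
    obtain ⟨s, m, n, e, hm, hn, rfl, hs, he'⟩ := hr'.susp_inv ha
    rw [Represents.unique ht hs, RepresentsEnv.unique he he', Int.ofNat.inj hm, Int.ofNat.inj hn]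

theorem RepresentsEnv.unique {h : Heap C V} {env : List EItem} {e e' : Env C V}
    (he : RepresentsEnv h env e) (he' : RepresentsEnv h env e') : e = e' := by
  match he with
  | .nil => cases he'; rfl
  | .dum (l := l) he =>
    generalize hx : (l : ℤ) = x at he'
    cases he' with
    | dum he' => rw [RepresentsEnv.unique he he', Int.ofNat.inj hx]
  | .bndg (l := l) ht he =>
    generalize hx : (l : ℤ) = x at he'
    cases he' with
    | bndg ht' he' =>
      rw [RepresentsEnv.unique he he', Represents.unique ht ht', Int.ofNat.inj hx]

end

mutual

theorem Represents.acc {h : Heap C V} {r : Ref} {t : STerm C V} (hr : Represents h r t) :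
    Acc (fun b a => Child h a b) r := by
  match hr with
  | .const ha | .fv ha | .bv ha =>
    refine ⟨_, fun b hb => ?_⟩
    obtain ⟨v, hv, hm⟩ := hb
    rw [ha] at hv
    cases hv
    cases hm
  | .ptr ha ht | .lam ha ht =>
    have ih := Represents.acc ht
    refine ⟨_, fun b hb => ?_⟩
    obtain ⟨v, hv, hm⟩ := hb
    rw [ha] at hv
    cases hv
    cases hm
    exact ih
  | .app ha h₁ h₂ =>
    have ih₁ := Represents.acc h₁
    have ih₂ := Represents.acc h₂
    refine ⟨_, fun b hb => ?_⟩
    obtain ⟨v, hv, hm⟩ := hb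
    rw [ha] at hv
    cases hv
    rcases hm with rfl | rfl
    exacts [ih₁, ih₂]
  | .susp ha ht he =>
    have ih := Represents.acc ht
    have ihe := RepresentsEnv.acc he
    refine ⟨_, fun b hb => ?_⟩
    obtain ⟨v, hv, hm⟩ := hb
    rw [ha] at hv
    cases hv
    rcases hm with rfl | ⟨l, hm⟩
    exacts [ih, ihe _ l hm]

theorem RepresentsEnv.acc {h : Heap C V} {env : List EItem} {e : Env C V}
    (he : RepresentsEnv h env e) :
    ∀ (r : Ref) (l : ℤ), EItem.bndg r l ∈ env → Acc (fun b a => Child h a b) r := by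
  match he with
  | .nil => intro r l hr; cases hr
  | .dum he => intro r l hr; exact RepresentsEnv.acc he r l (by simpa using hr)
  | .bndg ht he =>
    have ih := Represents.acc ht
    have ihe := RepresentsEnv.acc he
    intro r l hr
    rcases List.mem_cons.1 hr with hr | hr
    · cases hr; exact ih
    · exact ihe r l hr

end

/-- The graph below a reference that represents a term is acyclic. -/
theorem Represents.acyclic {h : Heap C V} {r : Ref} {t : STerm C V} (hr : Represents h r t) :
    ¬ Below h r r := by
  have key : ∀ x, Acc (fun b a => Child h a b) x → ∀ y, Reach h x y → Below h y x → False := by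
    intro x hx
    induction hx with
    | intro x _ ih =>
      intro y hy hyx
      obtain ⟨z, hxz, hzx⟩ := TransGen.head'_iff.1 (TransGen.trans_right hy hyx)
      exact ih z hxz x hzx (.single hxz)
  exact fun hb => key r hr.acc r .refl hb

theorem Represents.not_reach_of_below {h : Heap C V} {a b : Ref} {t : STerm C V}
    (ha : Represents h a t) (hab : Below h a b) : ¬ Reach h b a :=
  fun hba => ha.acyclic (TransGen.trans_left hab hba)

/-! ### Changes of one cell -/

/-- All cells of `h` except for the one at `a` have the same content in `h'`. -/
def AgreeOff (h h' : Heap C V) (a : Ref) : Prop :=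
  ∀ x v, x ≠ a → h[x]? = some v → h'[x]? = some v

mutual

theorem Represents.of_agreeOff {h h' : Heap C V} {a : Ref} (hag : AgreeOff h h' a) {r : Ref}
    {t : STerm C V} (hr : Represents h r t) (ha : ¬ Reach h r a) : Represents h' r t := by
  have hne : r ≠ a := fun e => ha (e ▸ .refl)
  have hc : ∀ b, Child h r b → ¬ Reach h b a := fun b hb hb' => ha (.head hb hb')
  match hr with
  | .const hx => exact .const (hag _ _ hne hx)
  | .fv hx => exact .fv (hag _ _ hne hx)
  | .bv hx => exact .bv (hag _ _ hne hx)
  | .ptr hx ht => exact .ptr (hag _ _ hne hx) (Represents.of_agreeOff hag ht (hc _ (.ptr hx)))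
  | .lam hx ht => exact .lam (hag _ _ hne hx) (Represents.of_agreeOff hag ht (hc _ (.lam hx)))
  | .app hx h₁ h₂ =>
    exact .app (hag _ _ hne hx) (Represents.of_agreeOff hag h₁ (hc _ (.appL hx)))
      (Represents.of_agreeOff hag h₂ (hc _ (.appR hx)))
  | .susp hx ht he =>
    exact .susp (hag _ _ hne hx) (Represents.of_agreeOff hag ht (hc _ (.susp hx)))
      (RepresentsEnv.of_agreeOff hag he fun _ _ hb => hc _ (.env hx hb))

theorem RepresentsEnv.of_agreeOff {h h' : Heap C V} {a : Ref} (hag : AgreeOff h h' a)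
    {env : List EItem} {e : Env C V} (he : RepresentsEnv h env e)
    (ha : ∀ b l, EItem.bndg b l ∈ env → ¬ Reach h b a) : RepresentsEnv h' env e := by
  match he with
  | .nil => exact .nil
  | .dum he =>
    exact .dum (RepresentsEnv.of_agreeOff hag he fun b l hb => ha b l (List.mem_cons_of_mem _ hb))
  | .bndg ht he =>
    exact .bndg (Represents.of_agreeOff hag ht (ha _ _ List.mem_cons_self))
      (RepresentsEnv.of_agreeOff hag he fun b l hb => ha b l (List.mem_cons_of_mem _ hb))

end

section Congruence

variable {S : STerm C V → STerm C V → Prop}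

theorem steps_app₂ {t₁ t₁' t₂ t₂' : STerm C V} (h₁ : ReflTransGen (TermStep S) t₁ t₁')
    (h₂ : ReflTransGen (TermStep S) t₂ t₂') :
    ReflTransGen (TermStep S) (.app t₁ t₂) (.app t₁' t₂') :=
  (h₁.lift (fun t => STerm.app t t₂) fun _ _ h => .appL _ h).trans
    (h₂.lift (fun t => STerm.app t₁' t) fun _ _ h => .appR _ h)

theorem steps_susp {t t' : STerm C V} {e e' : Env C V} (ol nl : ℕ)
    (ht : ReflTransGen (TermStep S) t t') (he : ReflTransGen (EnvStep S) e e') :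
    ReflTransGen (TermStep S) (.susp t ol nl e) (.susp t' ol nl e') :=
  (ht.lift (fun t => STerm.susp t ol nl e) fun _ _ h => .suspT _ _ _ h).trans
    (he.lift (fun e => STerm.susp t' ol nl e) fun _ _ h => .suspE _ _ _ h)

theorem steps_bnd {t t' : STerm C V} {e e' : Env C V} (l : ℕ)
    (ht : ReflTransGen (TermStep S) t t') (he : ReflTransGen (EnvStep S) e e') :
    ReflTransGen (EnvStep S) (.cons (.bnd t l) e) (.cons (.bnd t' l) e') :=
  (ht.lift (fun t => Env.cons (.bnd t l) e) fun _ _ h => .head _ _ h).trans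
    (he.lift (fun e => Env.cons (.bnd t' l) e) fun _ _ h => .tail _ h)

variable {h h' : Heap C V} {a : Ref} {u u' : STerm C V}

mutual

/-- Rewriting the term below one cell rewrites the terms of all references, because that cell may
be shared. -/
theorem Represents.rewrite (hag : AgreeOff h h' a) (hu : Represents h a u)
    (hu' : Represents h' a u') (hs : ReflTransGen (TermStep S) u u') {r : Ref} {t : STerm C V}
    (hr : Represents h r t) : ∃ t', Represents h' r t' ∧ ReflTransGen (TermStep S) t t' := by
  by_cases hne : r = a
  · subst hne
    rw [hr.unique hu]
    exact ⟨_, hu', hs⟩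
  match hr with
  | .const hx => exact ⟨_, .const (hag _ _ hne hx), .refl⟩
  | .fv hx => exact ⟨_, .fv (hag _ _ hne hx), .refl⟩
  | .bv hx => exact ⟨_, .bv (hag _ _ hne hx), .refl⟩
  | .ptr hx ht =>
    obtain ⟨t', ht', h₁⟩ := Represents.rewrite hag hu hu' hs ht
    exact ⟨_, .ptr (hag _ _ hne hx) ht', h₁⟩
  | .lam hx ht =>
    obtain ⟨t', ht', h₁⟩ := Represents.rewrite hag hu hu' hs ht
    exact ⟨_, .lam (hag _ _ hne hx) ht', h₁.lift STerm.lam fun _ _ h => .lam h⟩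
  | .app hx ht₁ ht₂ =>
    obtain ⟨t₁', ht₁', h₁⟩ := Represents.rewrite hag hu hu' hs ht₁
    obtain ⟨t₂', ht₂', h₂⟩ := Represents.rewrite hag hu hu' hs ht₂
    exact ⟨_, .app (hag _ _ hne hx) ht₁' ht₂', steps_app₂ h₁ h₂⟩
  | .susp hx ht he =>
    obtain ⟨t', ht', h₁⟩ := Represents.rewrite hag hu hu' hs ht
    obtain ⟨e', he', h₂⟩ := RepresentsEnv.rewrite hag hu hu' hs he
    exact ⟨_, .susp (hag _ _ hne hx) ht' he', steps_susp _ _ h₁ h₂⟩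

theorem RepresentsEnv.rewrite (hag : AgreeOff h h' a) (hu : Represents h a u)
    (hu' : Represents h' a u') (hs : ReflTransGen (TermStep S) u u') {env : List EItem}
    {e : Env C V} (he : RepresentsEnv h env e) :
    ∃ e', RepresentsEnv h' env e' ∧ ReflTransGen (EnvStep S) e e' := by
  match he with
  | .nil => exact ⟨_, .nil, .refl⟩
  | .dum he =>
    obtain ⟨e', he', h₁⟩ := RepresentsEnv.rewrite hag hu hu' hs he
    exact ⟨_, .dum he', h₁.lift _ fun _ _ h => .tail _ h⟩
  | .bndg ht he =>
    obtain ⟨t', ht', h₁⟩ := Represents.rewrite hag hu hu' hs ht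
    obtain ⟨e', he', h₂⟩ := RepresentsEnv.rewrite hag hu hu' hs he
    exact ⟨_, .bndg ht' he', steps_bnd _ h₁ h₂⟩

end

end Congruence

/-! ### Evolution of the heap -/

/-- The heap `h` evolves to `h'` by work below the reference `r` that rewrites terms by the rules
of `S`: only cells that are reachable from `r` change, no old cell becomes reachable from a
reference from which it was not, and all references that represent terms still do so, up to
rewriting. Dangling references in `h` may point to cells that are allocated in `h'`, so the second
property can hold only for references that represent terms. -/
structure Evolves (S : STerm C V → STerm C V → Prop) (h : Heap C V) (r : Ref) (h' : Heap C V) :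
    Prop where
  frame (x : Ref) (v : RawTerm C V) : h[x]? = some v → ¬ Reach h r x → h'[x]? = some v
  length_le : h.length ≤ h'.length
  reach {a b : Ref} {t : STerm C V} : Represents h a t → b < h.length → Reach h' a b → Reach h a b
  rewrite {a : Ref} {t : STerm C V} : Represents h a t →
    ∃ t', Represents h' a t' ∧ ReflTransGen (TermStep S) t t'

namespace Evolves

variable {S : STerm C V → STerm C V → Prop} {h h₁ h₂ : Heap C V} {r r₁ r₂ : Ref}

theorem refl (S : STerm C V → STerm C V → Prop) (h : Heap C V) (r : Ref) : Evolves S h r h where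
  frame _ _ hx _ := hx
  length_le := le_rfl
  reach _ _ hab := hab
  rewrite ha := ⟨_, ha, .refl⟩

theorem trans (he₁ : Evolves S h r h₁) (he₂ : Evolves S h₁ r h₂) {t : STerm C V}
    (hr : Represents h r t) : Evolves S h r h₂ where
  frame x v hx hn :=
    he₂.frame x v (he₁.frame x v hx hn) fun hc => hn (he₁.reach hr (lt_length hx) hc)
  length_le := he₁.length_le.trans he₂.length_le
  reach ha hb hab := by
    obtain ⟨t', ha', -⟩ := he₁.rewrite ha
    exact he₁.reach ha hb (he₂.reach ha' (hb.trans_le he₁.length_le) hab)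
  rewrite ha := by
    obtain ⟨t', ha', hs⟩ := he₁.rewrite ha
    obtain ⟨t'', ha'', hs'⟩ := he₂.rewrite ha'
    exact ⟨t'', ha'', hs.trans hs'⟩

theorem of_reach (he : Evolves S h r₁ h₁) (hr : Reach h r r₁) : Evolves S h r h₁ :=
  { he with frame := fun x v hx hn => he.frame x v hx fun hc => hn (hr.trans hc) }

theorem mono {S' : STerm C V → STerm C V → Prop} (he : Evolves S h r h₁)
    (hS : ∀ t t', S t t' → S' t t') : Evolves S' h r h₁ :=
  { he with
    rewrite := fun ha => by
      obtain ⟨t', ht', hs⟩ := he.rewrite ha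
      exact ⟨t', ht', hs.lift (fun t => t) fun _ _ hs => hs.mono hS⟩ }

/-- Work below `b` does not change the cells from which `b` is reachable. -/
theorem cell_eq (he : Evolves S h r₁ h₁) {t : STerm C V} {v : RawTerm C V} (hr : Represents h r t)
    (hb : Below h r r₁) (hv : h[r]? = some v) : h₁[r]? = some v :=
  he.frame _ _ hv (hr.not_reach_of_below hb)

theorem ptrPath (he : Evolves S h r₁ h₁) {t : STerm C V} (hr : Represents h r t)
    (hp : PtrPath h r r₁) : PtrPath h₁ r r₁ := by
  induction hp using ReflTransGen.head_induction_on generalizing t with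
  | refl => exact .refl
  | head hx hp ih =>
    exact .head (he.cell_eq hr (TransGen.head' (Child.ptr hx) (PtrPath.reach hp)) hx)
      (ih (hr.ptr_inv hx))

/-- A change of the cell at `a`, with allocation of new cells, where all references in this cell and
in the new cells are new or reachable from `a`. -/
theorem of_agreeOff {a : Ref} {u u' : STerm C V} (hag : AgreeOff h h₁ a)
    (hlen : h.length ≤ h₁.length) (hu : Represents h a u) (hu' : Represents h₁ a u')
    (hs : ReflTransGen (TermStep S) u u')
    (hnew : ∀ x b, x = a ∨ h.length ≤ x → Child h₁ x b → b < h.length → Reach h a b) :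
    Evolves S h a h₁ where
  frame x v hx hn := hag x v (fun e => hn (e ▸ .refl)) hx
  length_le := hlen
  rewrite ha := Represents.rewrite hag hu hu' hs ha
  reach {x b t} hx hb hxb := by
    have key : ((∃ t, Represents h x t) → Reach h x b) ∧ (h.length ≤ x → Reach h a b) := by
      clear hx t
      induction hxb using ReflTransGen.head_induction_on with
      | refl => exact ⟨fun _ => .refl, fun hx => absurd hb (Nat.not_lt.2 hx)⟩
      | @head x y hxy _ ih =>
        have haux : x = a ∨ h.length ≤ x → Reach h a b := by
          intro hx
          rcases Nat.lt_or_ge y h.length with hy | hy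
          · have hay := hnew x y hx hxy hy
            exact hay.trans (ih.1 (hu.reach hay))
          · exact ih.2 hy
        refine ⟨fun ⟨t, hx⟩ => ?_, fun hx => haux (.inr hx)⟩
        by_cases hxa : x = a
        · exact hxa ▸ haux (.inl hxa)
        · obtain ⟨v, hv⟩ := hx.exists_cell
          obtain ⟨v', hv', hm⟩ := hxy
          rw [hag x v hxa hv] at hv'
          cases hv'
          have hxy : Child h x y := ⟨v, hv, hm⟩
          exact .head hxy (ih.1 (hx.child hxy))
    exact key.1 ⟨t, hx⟩

end Evolves

theorem agreeOff_set (h : Heap C V) (a : Ref) (v : RawTerm C V) : AgreeOff h (h.set a v) a := by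
  intro x w hx hw
  rw [List.getElem?_set_ne (Ne.symm hx), hw]

theorem agreeOff_append_set (h l : Heap C V) (a : Ref) (v : RawTerm C V) :
    AgreeOff h ((h ++ l).set a v) a := by
  intro x w hx hw
  rw [List.getElem?_set_ne (Ne.symm hx), List.getElem?_append_left (lt_length hw), hw]

theorem Represents.getElem?_set {h : Heap C V} {a : Ref} {u : STerm C V} (hu : Represents h a u)
    (v : RawTerm C V) : (h.set a v)[a]? = some v :=
  List.getElem?_set_self hu.lt_length

/-- An assignment to the cell at `a` that uses only references below `a`. -/
theorem Evolves.set {S : STerm C V → STerm C V → Prop} {h : Heap C V} {a : Ref} {u u' : STerm C V}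
    {v : RawTerm C V} (hu : Represents h a u) (hv : ∀ b, v.Mentions b → Below h a b)
    (hu' : Represents (h.set a v) a u') (hs : ReflTransGen (TermStep S) u u') :
    Evolves S h a (h.set a v) := by
  refine .of_agreeOff (agreeOff_set h a v) (by simp) hu hu' hs fun x b hx hb hlt => ?_
  obtain ⟨w, hw, hm⟩ := hb
  have hxa : x = a := hx.resolve_right fun hx => by
    have := lt_length hw
    rw [List.length_set] at this
    exact absurd this (Nat.not_lt.2 hx)
  subst hxa
  rw [hu.getElem?_set] at hw
  cases hw
  exact (hv b hm).reach

theorem Represents.of_below {h h' : Heap C V} {a c : Ref} (hag : AgreeOff h h' a)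
    {u t : STerm C V} (hu : Represents h a u) (hc : Represents h c t) (hac : Below h a c) :
    Represents h' c t :=
  hc.of_agreeOff hag (hu.not_reach_of_below hac)

theorem RepresentsEnv.of_below {h h' : Heap C V} {a : Ref} (hag : AgreeOff h h' a)
    {u : STerm C V} {env : List EItem} {e : Env C V} (hu : Represents h a u)
    (he : RepresentsEnv h env e) (hac : ∀ b l, EItem.bndg b l ∈ env → Below h a b) :
    RepresentsEnv h' env e :=
  he.of_agreeOff hag fun b l hb => hu.not_reach_of_below (hac b l hb)

/-! ### Dereferencing, assignment and lookup -/

theorem Represents.deref {h : Heap C V} {r : Ref} {t : STerm C V} (hr : Represents h r t) :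
    ∃ r' v, deref h r = some r' ∧ (∀ a, assign h a r = some (h.set a (.ptr r'))) ∧
      h[r']? = some v ∧ (∀ x, v ≠ .ptr x) ∧ PtrPath h r r' ∧ Represents h r' t := by
  obtain ⟨v, hv⟩ := hr.exists_cell
  by_cases hp : ∃ x, v = .ptr x
  · obtain ⟨x, rfl⟩ := hp
    match hr with
    | .ptr hx ht =>
      obtain ⟨r', w, h₁, h₂, h₃, h₄, h₅, h₆⟩ := Represents.deref ht
      refine ⟨r', w, ?_, fun a => ?_, h₃, h₄, .head hx h₅, h₆⟩
      · rw [SuspNotation.deref, hx]; exact h₁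
      · rw [assign, hx]; exact h₂ a
    | .const hx | .fv hx | .bv hx | .lam hx _ | .app hx _ _ | .susp hx _ _ =>
      rw [hx] at hv; cases hv
  · refine ⟨r, v, ?_, fun a => ?_, hv, fun x hx => hp ⟨x, hx⟩, .refl, hr⟩
    · rw [SuspNotation.deref, hv]
      cases v <;> first | rfl | exact absurd ⟨_, rfl⟩ hp
    · rw [assign, hv]
      cases v <;> first | rfl | exact absurd ⟨_, rfl⟩ hp

theorem RepresentsEnv.nth_dum {h : Heap C V} {env : List EItem} {e : Env C V}
    (he : RepresentsEnv h env e) {n l : ℕ} (hn : e.get? n = some (.dum l)) :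
    nth env ((n : ℤ) + 1) = some (.dum l) := by
  match he, n, hn with
  | .dum _, 0, hn => simp only [Env.get?, Option.some.injEq, ETerm.dum.injEq] at hn; simp [nth, hn]
  | .bndg _ _, 0, hn => simp [Env.get?] at hn
  | .dum he, n + 1, hn | .bndg _ he, n + 1, hn =>
    have := RepresentsEnv.nth_dum he (n := n) hn
    rw [nth, if_neg (by omega)]
    simpa using this

theorem RepresentsEnv.nth_bnd {h : Heap C V} {env : List EItem} {e : Env C V}
    (he : RepresentsEnv h env e) {n l : ℕ} {t : STerm C V} (hn : e.get? n = some (.bnd t l)) :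
    ∃ r, nth env ((n : ℤ) + 1) = some (.bndg r l) ∧ EItem.bndg r l ∈ env ∧ Represents h r t := by
  match he, n, hn with
  | .dum _, 0, hn => simp [Env.get?] at hn
  | .bndg ht _, 0, hn =>
    simp only [Env.get?, Option.some.injEq, ETerm.bnd.injEq] at hn
    obtain ⟨rfl, rfl⟩ := hn
    exact ⟨_, by simp [nth], List.mem_cons_self, ht⟩
  | .dum he, n + 1, hn | .bndg _ he, n + 1, hn =>
    obtain ⟨r, h₁, h₂, h₃⟩ := RepresentsEnv.nth_bnd he (n := n) hn
    refine ⟨r, ?_, List.mem_cons_of_mem _ h₂, h₃⟩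
    rw [nth, if_neg (by omega)]
    simpa using h₁

/-! ### Lazy reading -/

theorem Represents.of_ptrPath {h : Heap C V} {r r' : Ref} {t : STerm C V} (hr : Represents h r t)
    (hp : PtrPath h r r') : Represents h r' t := by
  induction hp with
  | refl => exact hr
  | tail _ hx ih => exact ih.ptr_inv hx

theorem Evolves.rewriteEnv {S : STerm C V → STerm C V → Prop} {h h' : Heap C V} {r : Ref}
    (hev : Evolves S h r h') {env : List EItem} {e : Env C V} (he : RepresentsEnv h env e) :
    ∃ e', RepresentsEnv h' env e' ∧ ReflTransGen (EnvStep S) e e' := by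
  match he with
  | .nil => exact ⟨_, .nil, .refl⟩
  | .dum he =>
    obtain ⟨e', he', h₁⟩ := Evolves.rewriteEnv hev he
    exact ⟨_, .dum he', h₁.lift _ fun _ _ h => .tail _ h⟩
  | .bndg ht he =>
    obtain ⟨t', ht', h₁⟩ := hev.rewrite ht
    obtain ⟨e', he', h₂⟩ := Evolves.rewriteEnv hev he
    exact ⟨_, .bndg ht' he', steps_bnd _ h₁ h₂⟩

/-- What `lazyRead` achieves on references to terms of cost `n`. The cost decreases strictly if
there is a suspension to be read. -/
def LazyReadSpec (C V : Type) (n : ℕ) : Prop :=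
  ∀ (h : Heap C V) (r : Ref) (t : STerm C V), Represents h r t → t.WF → t.readCost = n →
    ∃ h', lazyRead h r = some h' ∧ Evolves ReadingRule h r h' ∧
      ∀ q ol nl env, h[r]? = some (.susp q ol nl env) →
        ∃ s, Represents h' r s ∧ s.readCost < n

/-- What `lazyReadAux` achieves on suspensions of cost `n`. -/
def LazyReadAuxSpec (C V : Type) (n : ℕ) : Prop :=
  ∀ (h : Heap C V) (a q q' : Ref) (ol nl : ℤ) (env : List EItem) (u : STerm C V)
    (v : RawTerm C V),
    h[a]? = some (.susp q ol nl env) → Represents h a u → u.WF → u.readCost = n →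
    PtrPath h q q' → h[q']? = some v → (∀ x, v ≠ .ptr x) →
    ∃ h', lazyReadAux h a q' ol nl env = some h' ∧ Evolves ReadingRule h a h' ∧
      ∃ s, Represents h' a s ∧ s.readCost < n

theorem LazyReadAuxSpec.lazyReadSpec {n : ℕ} (hA : LazyReadAuxSpec C V n) :
    LazyReadSpec C V n := by
  intro h r t hr hwf hn
  obtain ⟨v, hv⟩ := hr.exists_cell
  cases v with
  | susp q ol nl env =>
    obtain ⟨s, _, _, _, -, -, -, hq, -⟩ := hr.susp_inv hv
    obtain ⟨q', v, hd, -, hv', hnp, hp, -⟩ := hq.deref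
    obtain ⟨h', he, hev, hs⟩ := hA h r q q' ol nl env t v hv hr hwf hn hp hv' hnp
    refine ⟨h', ?_, hev, fun _ _ _ _ _ => hs⟩
    rw [lazyRead, hv]
    change (deref h q).bind _ = _
    rw [hd]
    exact he
  | _ =>
    refine ⟨h, by rw [lazyRead, hv]; rfl, .refl _ _ _, fun q ol nl env hx => ?_⟩
    rw [hv] at hx; cases hx

/-- One assignment that applies a reading rule at `a` and decreases the cost. -/
theorem lazyRead_set {h : Heap C V} {a : Ref} {u u' : STerm C V} {v : RawTerm C V}
    (hu : Represents h a u) (hv : ∀ b, v.Mentions b → Below h a b)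
    (hu' : Represents (h.set a v) a u') (hs : ReadingRule u u') (hc : u'.readCost < u.readCost) :
    Evolves ReadingRule h a (h.set a v) ∧ ∃ s, Represents (h.set a v) a s ∧
      s.readCost < u.readCost :=
  ⟨.set hu hv hu' (.single (.root hs)), u', hu', hc⟩

/-- One assignment that applies a reading rule at `a` and decreases the cost, followed by lazy
reading. -/
theorem lazyRead_after {h h₁ : Heap C V} {a : Ref} {u u' : STerm C V}
    (hL : ∀ m < u.readCost, LazyReadSpec C V m) (hu : Represents h a u) (hwf : u.WF)
    (hev : Evolves ReadingRule h a h₁) (hu' : Represents h₁ a u') (hs : ReadingRule u u')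
    (hc : u'.readCost < u.readCost) :
    ∃ h', lazyRead h₁ a = some h' ∧ Evolves ReadingRule h a h' ∧
      ∃ s, Represents h' a s ∧ s.readCost < u.readCost := by
  obtain ⟨h', he, hev', -⟩ := hL _ hc h₁ a u' hu' (hs.wf hwf) rfl
  obtain ⟨s, hs', hr⟩ := hev'.rewrite hu'
  exact ⟨h', he, hev.trans hev' hu, s, hs', (Reads.readCost_le hr).trans_lt hc⟩

/-- The body is a variable reference: the rules (r3), (r4), and (r10)-(r12), of which the last three
put another suspension in place that may have to be read. -/
theorem lazyReadAux_bv {n : ℕ} (hA : ∀ m < n, LazyReadAuxSpec C V m) {h : Heap C V}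
    {a q q' : Ref} {ol nl i : ℤ} {env : List EItem} {u : STerm C V}
    (ha : h[a]? = some (.susp q ol nl env)) (hu : Represents h a u) (hwf : u.WF)
    (hn : u.readCost = n) (hp : PtrPath h q q') (hv : h[q']? = some (.bv i)) :
    ∃ h', lazyReadAux h a q' ol nl env = some h' ∧ Evolves ReadingRule h a h' ∧
      ∃ s, Represents h' a s ∧ s.readCost < n := by
  have hL : ∀ m < u.readCost, LazyReadSpec C V m := fun m hm => (hA m (hn ▸ hm)).lazyReadSpec
  subst hn
  obtain ⟨s, ol, nl, e, rfl, rfl, rfl, hq, he⟩ := hu.susp_inv ha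
  obtain ⟨k, rfl, rfl⟩ := (hq.of_ptrPath hp).bv_inv hv
  have hw := hwf
  rw [STerm.WF] at hw
  obtain ⟨-, -, hlen, hfits, -⟩ := hw
  by_cases hk : ol ≤ k
  · obtain ⟨k, rfl⟩ := Nat.exists_eq_add_of_le hk
    refine ⟨h.set a (.bv ((ol + k : ℕ) + 1 + nl - ol)), ?_, lazyRead_set hu (fun _ hb => hb.elim)
      (.bv (n := k + nl) ?_) (.r3 k ol nl e) (by simp only [STerm.readCost]; omega)⟩
    · rw [lazyReadAux, hv]
      exact if_pos (by push_cast; omega)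
    · rw [hu.getElem?_set]
      congr 2; push_cast; ring
  · have hk : k < ol := Nat.lt_of_not_le hk
    obtain ⟨et, het⟩ := Env.exists_get? (hlen ▸ hk : k < e.length)
    have hcost := Env.readCost_le_of_get? het
    cases et with
    | dum l =>
      obtain ⟨m, hm⟩ := Nat.exists_eq_add_of_lt (hfits.lt_of_get? het)
      refine ⟨h.set a (.bv ((nl : ℤ) - l)), ?_, lazyRead_set hu (fun _ hb => hb.elim)
        (.bv (n := m) ?_) (.r4 k ol nl l m e hk het hm) (by simp only [STerm.readCost]; omega)⟩
      · rw [lazyReadAux, hv]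
        change ite _ _ _ = _
        rw [if_neg (by omega), he.nth_dum het]
        rfl
      · rw [hu.getElem?_set]
        congr 2; omega
    | bnd t l =>
      obtain ⟨r, hnth, hmem, hrt⟩ := he.nth_bnd het
      have hbr : Below h a r := .single (.env ha hmem)
      obtain ⟨j, hj⟩ := Nat.exists_eq_add_of_le (hfits.le_of_get? het)
      obtain ⟨r', v, hd, hassign, hv', hnp, hpr, hrt'⟩ := hrt.deref
      have hbr' : Below h a r' := TransGen.trans_left hbr hpr.reach
      rw [ETerm.readCost] at hcost
      by_cases hl : nl = l
      · subst hl
        have hu' : Represents (h.set a (.ptr r')) a t :=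
          .ptr (hu.getElem?_set _) (.of_below (agreeOff_set _ _ _) hu hrt' hbr')
        obtain ⟨h', hh', hev, hs⟩ := lazyRead_after hL hu hwf
          (.set hu (fun b hb => by cases hb; exact hbr') hu'
            (.single (.root (.r10 k ol nl e t hk het)))) hu' (.r10 k ol nl e t hk het)
          (by simp only [STerm.readCost]; omega)
        refine ⟨h', ?_, hev, hs⟩
        rw [lazyReadAux, hv]
        change ite _ _ _ = _
        rw [if_neg (by omega), hnth]
        change ite _ _ _ = _
        rw [if_pos rfl, hassign]
        exact hh'
      · by_cases hsusp : ∃ q₂ ol₂ nl₂ env₂, v = .susp q₂ ol₂ nl₂ env₂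
        · obtain ⟨q₂, ol₂, nl₂, env₂, rfl⟩ := hsusp
          obtain ⟨t₂, ol₂, nl₂, e₂, rfl, rfl, rfl, hq₂, he₂⟩ := hrt'.susp_inv hv'
          have hrule := ReadingRule.r11 k ol nl l j ol₂ nl₂ e e₂ t₂ hk het hj hl
          have hb₂ : Below h a q₂ := hbr'.tail (.susp hv')
          have hbe : ∀ b m, EItem.bndg b m ∈ env₂ → Below h a b :=
            fun b m hb => hbr'.tail (.env hv' hb)
          have hcell : (RawTerm.susp q₂ ol₂ ((nl₂ : ℤ) + nl - l) env₂ : RawTerm C V) =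
              .susp q₂ ol₂ ((nl₂ + j : ℕ) : ℤ) env₂ := by
            congr 1; omega
          have hu' : Represents (h.set a (.susp q₂ ol₂ ((nl₂ : ℤ) + nl - l) env₂)) a
              (.susp t₂ ol₂ (nl₂ + j) e₂) := by
            rw [hcell]
            exact .susp (hu.getElem?_set _) (.of_below (agreeOff_set _ _ _) hu hq₂ hb₂)
              (.of_below (agreeOff_set _ _ _) hu he₂ hbe)
          obtain ⟨h', hh', hev, hs⟩ := lazyRead_after hL hu hwf
            (.set hu (fun b hb => by
              rcases hb with rfl | ⟨m, hb⟩
              exacts [hb₂, hbe b m hb]) hu' (.single (.root hrule))) hu' hrule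
            (by simp only [STerm.readCost] at hcost ⊢; omega)
          refine ⟨h', ?_, hev, hs⟩
          rw [lazyReadAux, hv]
          change ite _ _ _ = _
          rw [if_neg (by omega), hnth]
          change ite _ _ _ = _
          rw [if_neg (by omega), hd]
          change (h[r']?).bind _ = _
          rw [hv']
          exact hh'
        · have hns : ∀ t' ol' nl' e', t ≠ STerm.susp t' ol' nl' e' := by
            rintro t' ol' nl' e' rfl
            cases hrt' with
            | ptr hx => rw [hx] at hv'; cases hv'; exact hnp _ rfl
            | susp hx => rw [hx] at hv'; cases hv'; exact hsusp ⟨_, _, _, _, rfl⟩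
          have hrule := ReadingRule.r12 k ol nl l j e t hk het hj hl hns
          have hcell : (RawTerm.susp r' 0 ((nl : ℤ) - l) [] : RawTerm C V) =
              .susp r' ((0 : ℕ) : ℤ) (j : ℤ) [] := by
            congr 1; omega
          have hu' : Represents (h.set a (.susp r' 0 ((nl : ℤ) - l) [])) a
              (.susp t 0 j .nil) := by
            rw [hcell]
            exact .susp (hu.getElem?_set _) (.of_below (agreeOff_set _ _ _) hu hrt' hbr') .nil
          obtain ⟨h', hh', hev, hs⟩ := lazyRead_after hL hu hwf
            (.set hu (fun b hb => by
              rcases hb with rfl | ⟨m, hb⟩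
              exacts [hbr', absurd hb (by simp)]) hu' (.single (.root hrule))) hu' hrule
            (by simp only [STerm.readCost, Env.readCost]; omega)
          refine ⟨h', ?_, hev, hs⟩
          rw [lazyReadAux, hv]
          change ite _ _ _ = _
          rw [if_neg (by omega), hnth]
          change ite _ _ _ = _
          rw [if_neg (by omega), hd]
          change (h[r']?).bind _ = _
          rw [hv']
          cases v with
          | susp => exact absurd ⟨_, _, _, _, rfl⟩ hsusp
          | _ => exact hh'

/-- The body is an application, and the rule (r6) is applied with two new cells. -/
theorem lazyReadAux_app {n : ℕ} {h : Heap C V}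
    {a : ℕ} {q q' r₁ r₂ : Ref} {ol nl : ℤ} {env : List EItem} {u : STerm C V}
    (ha : h[a]? = some (.susp q ol nl env)) (hu : Represents h a u)
    (hn : u.readCost = n) (hp : PtrPath h q q') (hv : h[q']? = some (.app r₁ r₂)) :
    ∃ h', lazyReadAux h a q' ol nl env = some h' ∧ Evolves ReadingRule h a h' ∧
      ∃ s, Represents h' a s ∧ s.readCost < n := by
  subst hn
  obtain ⟨s, ol, nl, e, rfl, rfl, rfl, hq, he⟩ := hu.susp_inv ha
  obtain ⟨s₁, s₂, rfl, hs₁, hs₂⟩ := (hq.of_ptrPath hp).app_inv hv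
  have hbq : Below h a q' := TransGen.trans_left (.single (.susp ha)) hp.reach
  have hb₁ : Below h a r₁ := hbq.tail (.appL hv)
  have hb₂ : Below h a r₂ := hbq.tail (.appR hv)
  have hbe : ∀ b m, EItem.bndg b m ∈ env → Below h a b := fun b m hb => .single (.env ha hb)
  have hlt : a < h.length := hu.lt_length
  generalize hh' : (h ++ [RawTerm.susp r₁ (ol : ℤ) (nl : ℤ) env, .susp r₂ (ol : ℤ) (nl : ℤ) env]).set
    a (.app h.length (h.length + 1)) = h'
  have hag : AgreeOff h h' a := hh' ▸ agreeOff_append_set _ _ _ _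
  have hlen : h'.length = h.length + 2 := by simp [← hh']
  have hca : h'[a]? = some (.app h.length (h.length + 1)) := by
    rw [← hh', List.getElem?_set_self (by simp; omega)]
  have hc₁ : h'[h.length]? = some (.susp r₁ ol nl env) := by
    rw [← hh', List.getElem?_set_ne (by omega)]; simp
  have hc₂ : h'[h.length + 1]? = some (.susp r₂ ol nl env) := by
    rw [← hh', List.getElem?_set_ne (by omega)]; simp
  have hu' : Represents h' a (.app (.susp s₁ ol nl e) (.susp s₂ ol nl e)) :=
    .app hca (.susp hc₁ (.of_below hag hu hs₁ hb₁) (.of_below hag hu he hbe))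
      (.susp hc₂ (.of_below hag hu hs₂ hb₂) (.of_below hag hu he hbe))
  refine ⟨h', ?_, .of_agreeOff hag (by omega) hu hu' (.single (.root (.r6 _ _ _ _ _))) ?_,
    _, hu', by simp only [STerm.readCost]; omega⟩
  · rw [lazyReadAux, hv]
    exact congrArg some hh'
  · rintro (x : ℕ) b hx ⟨w, hw, hm⟩ hb
    have hx : x = a ∨ x = h.length ∨ x = h.length + 1 := by
      have : x < h.length + 2 := hlen ▸ lt_length hw
      rcases hx with hx | hx
      · exact .inl hx
      · have hx : h.length ≤ x := hx
        omega
    rcases hx with rfl | rfl | rfl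
    · rw [hca] at hw; cases hw
      rcases hm with rfl | rfl
      · exact absurd hb (Nat.lt_irrefl _)
      · exact absurd hb (Nat.not_lt.2 (Nat.le_succ _))
    · rw [hc₁] at hw; cases hw
      rcases hm with rfl | ⟨m, hm⟩
      exacts [hb₁.reach, (hbe b m hm).reach]
    · rw [hc₂] at hw; cases hw
      rcases hm with rfl | ⟨m, hm⟩
      exacts [hb₂.reach, (hbe b m hm).reach]

/-- The body is an abstraction, and the rule (r7) is applied with one new cell. -/
theorem lazyReadAux_lam {n : ℕ} {h : Heap C V}
    {a : ℕ} {q q' r₁ : Ref} {ol nl : ℤ} {env : List EItem} {u : STerm C V}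
    (ha : h[a]? = some (.susp q ol nl env)) (hu : Represents h a u)
    (hn : u.readCost = n) (hp : PtrPath h q q') (hv : h[q']? = some (.lam r₁)) :
    ∃ h', lazyReadAux h a q' ol nl env = some h' ∧ Evolves ReadingRule h a h' ∧
      ∃ s, Represents h' a s ∧ s.readCost < n := by
  subst hn
  obtain ⟨s, ol, nl, e, rfl, rfl, rfl, hq, he⟩ := hu.susp_inv ha
  obtain ⟨s₁, rfl, hs₁⟩ := (hq.of_ptrPath hp).lam_inv hv
  have hbq : Below h a q' := TransGen.trans_left (.single (.susp ha)) hp.reach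
  have hb₁ : Below h a r₁ := hbq.tail (.lam hv)
  have hbe : ∀ b m, EItem.bndg b m ∈ env → Below h a b := fun b m hb => .single (.env ha hb)
  have hlt : a < h.length := hu.lt_length
  generalize hh' : (h ++ [RawTerm.susp r₁ ((ol : ℤ) + 1) ((nl : ℤ) + 1) (.dum nl :: env)]).set
    a (.lam h.length) = h'
  have hag : AgreeOff h h' a := hh' ▸ agreeOff_append_set _ _ _ _
  have hlen : h'.length = h.length + 1 := by simp [← hh']
  have hca : h'[a]? = some (.lam h.length) := by
    rw [← hh', List.getElem?_set_self (by simp; omega)]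
  have hc₁ : h'[h.length]? = some (.susp r₁ (ol + 1 : ℕ) (nl + 1 : ℕ) (.dum nl :: env)) := by
    rw [← hh', List.getElem?_set_ne (by omega)]; simp
  have hu' : Represents h' a (.lam (.susp s₁ (ol + 1) (nl + 1) (.cons (.dum nl) e))) :=
    .lam hca (.susp hc₁ (.of_below hag hu hs₁ hb₁) (.dum (.of_below hag hu he hbe)))
  refine ⟨h', ?_, .of_agreeOff hag (by omega) hu hu' (.single (.root (.r7 _ _ _ _))) ?_,
    _, hu', by simp only [STerm.readCost]; omega⟩
  · rw [lazyReadAux, hv]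
    exact congrArg some hh'
  · rintro (x : ℕ) b hx ⟨w, hw, hm⟩ hb
    have hx : x = a ∨ x = h.length := by
      have : x < h.length + 1 := hlen ▸ lt_length hw
      rcases hx with hx | hx
      · exact .inl hx
      · have hx : h.length ≤ x := hx
        omega
    rcases hx with rfl | rfl
    · rw [hca] at hw; cases hw
      cases hm
      exact absurd hb (Nat.lt_irrefl _)
    · rw [hc₁] at hw; cases hw
      rcases hm with rfl | ⟨m, hm⟩
      exacts [hb₁.reach, (hbe b m (by simpa using hm)).reach]

/-- The body is itself a suspension: it is read in place, with the effect of lowering the cost of the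
outer suspension, which is then read in turn. -/
theorem lazyReadAux_susp {n : ℕ} (hA : ∀ m < n, LazyReadAuxSpec C V m) {h : Heap C V}
    {a q q' q₁ : Ref} {ol nl ol₁ nl₁ : ℤ} {env env₁ : List EItem} {u : STerm C V}
    (ha : h[a]? = some (.susp q ol nl env)) (hu : Represents h a u) (hwf : u.WF)
    (hn : u.readCost = n) (hp : PtrPath h q q') (hv : h[q']? = some (.susp q₁ ol₁ nl₁ env₁)) :
    ∃ h', lazyReadAux h a q' ol nl env = some h' ∧ Evolves ReadingRule h a h' ∧
      ∃ s, Represents h' a s ∧ s.readCost < n := by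
  subst hn
  obtain ⟨s, m, l, e, hm, hl, rfl, hq, he⟩ := hu.susp_inv ha
  have hq' := hq.of_ptrPath hp
  have hw := hwf
  rw [STerm.WF] at hw
  have hlt : s.readCost < (STerm.susp s m l e).readCost := by
    simp only [STerm.readCost]; omega
  obtain ⟨h₁, hh₁, hev₁, hs₁⟩ := (hA _ hlt).lazyReadSpec h q' s hq' hw.1 rfl
  obtain ⟨s₁, hqs₁, hc₁⟩ := hs₁ _ _ _ _ hv
  have hbq : Below h a q' := TransGen.trans_left (.single (.susp ha)) hp.reach
  have ha₁ := hev₁.cell_eq hu hbq ha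
  have hp₁ := hev₁.ptrPath hq hp
  obtain ⟨q₂, v₂, hd, -, hv₂, hnp, hp₂, hqs₂⟩ := hqs₁.deref
  obtain ⟨u₁, hu₁, hr⟩ := hev₁.rewrite hu
  have hwf₁ := (Reads.wf_toDB hr hwf).1
  obtain ⟨e₁, he₁, hre⟩ := hev₁.rewriteEnv he
  -- Reading `u` to `u₁` need not lower the cost; the strict decrease comes from the subterm, as long
  -- as the cost of the environment has not grown.
  have hce : e₁.readCost ≤ e.readCost := by
    clear he₁
    induction hre with
    | refl => exact le_rfl
    | tail _ hs ih => exact hs.readCost_le.trans ih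
  have hcu : u₁.readCost < (STerm.susp s m l e).readCost := by
    obtain ⟨s', _, _, e', -, -, rfl, hq₁, he'⟩ := hu₁.susp_inv ha₁
    rw [he'.unique he₁, (hq₁.of_ptrPath hp₁).unique hqs₁]
    simp only [STerm.readCost]; omega
  obtain ⟨h₂, hh₂, hev₂, s₂, hs₂, hcs₂⟩ :=
    hA _ hcu h₁ a q q₂ ol nl env u₁ v₂ ha₁ hu₁ hwf₁ rfl (hp₁.trans hp₂) hv₂ hnp
  refine ⟨h₂, ?_, (hev₁.of_reach hbq.reach).trans hev₂ hu, s₂, hs₂, hcs₂.trans hcu⟩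
  rw [lazyReadAux, hv]
  change (lazyRead h q').bind _ = _
  rw [hh₁]
  change (deref h₁ q').bind _ = _
  rw [hd]
  exact hh₂

theorem lazyReadAuxSpec (n : ℕ) : LazyReadAuxSpec C V n := by
  induction n using Nat.strong_induction_on with
  | _ n hA =>
  intro h a q q' ol nl env u v ha hu hwf hn hp hv hnp
  cases v with
  | const c =>
    obtain ⟨s, ol, nl, e, rfl, rfl, rfl, hq, he⟩ := hu.susp_inv ha
    obtain rfl := (hq.of_ptrPath hp).const_inv hv
    subst hn
    exact ⟨h.set a (.const c), by rw [lazyReadAux, hv]; rfl, lazyRead_set hu (fun _ hb => hb.elim)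
      (.const (hu.getElem?_set _)) (.r1 c _ _ _) (by simp only [STerm.readCost]; omega)⟩
  | fv x =>
    obtain ⟨s, ol, nl, e, rfl, rfl, rfl, hq, he⟩ := hu.susp_inv ha
    obtain rfl := (hq.of_ptrPath hp).fv_inv hv
    subst hn
    exact ⟨h.set a (.fv x), by rw [lazyReadAux, hv]; rfl, lazyRead_set hu (fun _ hb => hb.elim)
      (.fv (hu.getElem?_set _)) (.r2 x _ _ _) (by simp only [STerm.readCost]; omega)⟩
  | bv i => exact lazyReadAux_bv hA ha hu hwf hn hp hv
  | ptr x => exact absurd rfl (hnp x)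
  | lam r₁ => exact lazyReadAux_lam ha hu hn hp hv
  | app r₁ r₂ => exact lazyReadAux_app ha hu hn hp hv
  | susp => exact lazyReadAux_susp hA ha hu hwf hn hp hv

theorem Represents.lazyRead {h : Heap C V} {r : Ref} {t : STerm C V} (hr : Represents h r t)
    (hwf : t.WF) :
    ∃ h', lazyRead h r = some h' ∧ Evolves ReadingRule h r h' ∧
      ∀ q ol nl env, h[r]? = some (.susp q ol nl env) →
        ∃ s, Represents h' r s ∧ s.readCost < t.readCost :=
  (lazyReadAuxSpec _).lazyReadSpec h r t hr hwf rfl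

/-! ### Head normalization -/

/-- The rules that `Rewrites` applies. -/
abbrev HeadRule (t t' : STerm C V) : Prop := ReadingRule t t' ∨ BetaRule t t'

/-- Generalized weak head normal forms (if the flag is true) and generalized head normal forms (if
it is false). -/
inductive STerm.NF : Bool → STerm C V → Prop
  | neutral (w : Bool) {t : STerm C V} : STerm.Neutral t → NF w t
  | weak (t : STerm C V) : NF true (.lam t)
  | lam {t : STerm C V} : NF false t → NF false (.lam t)

theorem STerm.NF.ghnf {t : STerm C V} (h : STerm.NF false t) : t.GHNF := by
  generalize hw : false = w at h
  induction h with
  | neutral _ h => exact .neutral h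
  | weak => cases hw
  | lam _ ih => exact .lam (ih hw)

/-- The result of head normalization at `r` in the heap `h`. -/
def HnExTerminates (h : Heap C V) (r : Ref) (w : Bool) : Prop :=
  ∃ h', hnEx h r w = some h' ∧ Evolves HeadRule h r h' ∧ ∃ s, Represents h' r s ∧ s.NF w

/-- Indirections are passed through; the assignment afterwards shortens them and does not change the
represented term. -/
theorem HnExTerminates.of_ptrPath {h : Heap C V} {r r' : Ref} {w : Bool} {t : STerm C V}
    (hr : Represents h r t) (hp : PtrPath h r r') (hn : HnExTerminates h r' w) :
    HnExTerminates h r w := by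
  induction hp using ReflTransGen.head_induction_on generalizing t with
  | refl => exact hn
  | @head a b hx hp ih =>
    obtain ⟨h₁, hh₁, hev₁, s, hs, hnf⟩ := ih (hr.ptr_inv hx)
    have hab : Below h a b := .single (.ptr hx)
    have hx₁ := hev₁.cell_eq hr hab hx
    have has : Represents h₁ a s := .ptr hx₁ hs
    obtain ⟨c, _, -, hassign, -, -, hpc, hc⟩ := hs.deref
    have hac : Below h₁ a c := TransGen.head' (.ptr hx₁) hpc.reach
    have has' : Represents (h₁.set a (.ptr c)) a s :=
      .ptr (has.getElem?_set _) (.of_below (agreeOff_set _ _ _) has hc hac)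
    refine ⟨h₁.set a (.ptr c), ?_, (hev₁.of_reach hab.reach).trans
      (.set has (fun y hy => by cases hy; exact hac) has' .refl) hr, s, has', hnf⟩
    rw [hnEx, hx]
    change (hnEx h b w).bind _ = _
    rw [hh₁]
    exact hassign a

/-- A `β`-contraction at `r` performs one of the rules (βₛ) and (β'ₛ). -/
theorem Represents.exists_betaContract {h : Heap C V} {r b c : Ref} {s u : STerm C V}
    (hr : Represents h r (.app (.lam s) u)) (hwf : s.WF) (hs : Represents h b s)
    (hu : Represents h c u) (hb : Below h r b) (hc : Below h r c) :
    ∃ h', betaContract h r b c = some h' ∧ Evolves HeadRule h r h' ∧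
      ∃ t, Represents h' r t ∧ BetaRule (.app (.lam s) u) t := by
  have hset : ∀ {v : RawTerm C V} {t : STerm C V}, betaContract h r b c = some (h.set r v) →
      (∀ x, v.Mentions x → Below h r x) → Represents (h.set r v) r t →
      BetaRule (.app (.lam s) u) t → ∃ h', betaContract h r b c = some h' ∧
        Evolves HeadRule h r h' ∧ ∃ t, Represents h' r t ∧ BetaRule (.app (.lam s) u) t :=
    fun he hv ht hrule =>
      ⟨_, he, .set hr hv ht (.single (.root (.inr hrule))), _, ht, hrule⟩
  have hc' : ∀ v, Represents (h.set r v) c u := fun v => .of_below (agreeOff_set _ _ _) hr hu hc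
  have hplain : betaContract h r b c = some (h.set r (.susp b 1 0 [.bndg c 0])) →
      ∃ h', betaContract h r b c = some h' ∧ Evolves HeadRule h r h' ∧
        ∃ t, Represents h' r t ∧ BetaRule (.app (.lam s) u) t := by
    intro he
    refine hset he (fun x hx => ?_) (.susp (ol := 1) (nl := 0) (hr.getElem?_set _)
      (.of_below (agreeOff_set _ _ _) hr hs hb) (.bndg (l := 0) (hc' _) .nil)) (.beta s u)
    rcases hx with rfl | ⟨l, hx⟩
    · exact hb
    · simp only [List.mem_singleton, EItem.bndg.injEq] at hx
      exact hx.1 ▸ hc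
  obtain ⟨v, hv⟩ := hs.exists_cell
  cases v with
  | susp b₁ ol nl env =>
    cases env with
    | nil => exact hplain (by rw [betaContract, hv]; rfl)
    | cons item env =>
      cases item with
      | bndg => exact hplain (by rw [betaContract, hv]; rfl)
      | dum l =>
        by_cases hl : nl = l + 1
        · obtain ⟨t, m, n, e, rfl, rfl, rfl, ht, he⟩ := hs.susp_inv hv
          cases he with
          | @dum k _ e he =>
            obtain rfl : n = k + 1 := by exact_mod_cast hl
            rw [STerm.WF] at hwf
            obtain rfl : e.length + 1 = m := hwf.2.2.1
            have hb₁ : Below h r b₁ := hb.tail (.susp hv)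
            have hbe : ∀ x l, EItem.bndg x l ∈ env → Below h r x :=
              fun x l hx => hb.tail (.env hv (List.mem_cons_of_mem _ hx))
            refine hset (v := .susp b₁ ((e.length + 1 : ℕ) : ℤ) k (.bndg c k :: env)) ?_
              (fun x hx => ?_) (.susp (hr.getElem?_set _)
                (.of_below (agreeOff_set _ _ _) hr ht hb₁)
                (.bndg (hc' _) (.of_below (agreeOff_set _ _ _) hr he hbe)))
              (.beta' t u e.length k e)
            · rw [betaContract, hv]
              exact if_pos hl
            · rcases hx with rfl | ⟨l, hx⟩
              · exact hb₁
              · rcases List.mem_cons.1 hx with hx | hx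
                · cases hx; exact hc
                · exact hbe x l hx
        · refine hplain ?_
          rw [betaContract, hv]
          exact if_neg hl
  | _ => exact hplain (by rw [betaContract, hv]; rfl)

/-- Head normalization terminates on terms whose de Bruijn terms need at most `n` head reduction
steps and have size `m`, and whose reading cost is `k`. -/
def HnExSpec (C V : Type) (n m k : ℕ) : Prop :=
  ∀ (h : Heap C V) (r : Ref) (w : Bool) (t : STerm C V), Represents h r t → t.WF →
    DB.HNorm w n t.toDB → sizeOf t.toDB = m → t.readCost = k → HnExTerminates h r w

theorem HnExTerminates.app {n m : ℕ} (hn : ∀ n' < n, ∀ m k, HnExSpec C V n' m k)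
    (hm : ∀ m' < m, ∀ k, HnExSpec C V n m' k) {h : Heap C V} {r r₁ r₂ : Ref} {w : Bool}
    {t : STerm C V} (hr : Represents h r t) (hwf : t.WF) (hnt : DB.HNorm w n t.toDB)
    (hmt : sizeOf t.toDB = m) (hv : h[r]? = some (.app r₁ r₂)) : HnExTerminates h r w := by
  obtain ⟨t₁, t₂, rfl, h₁, h₂⟩ := hr.app_inv hv
  have hw := hwf
  rw [STerm.WF] at hw
  rw [STerm.toDB] at hnt hmt
  obtain ⟨g₁, hg₁, hev₁, s₁, hs₁, hnf₁⟩ :=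
    hm _ (by rw [← hmt, DB.app.sizeOf_spec]; omega) _ h r₁ true t₁ h₁ hw.1 hnt.of_app rfl rfl
  have hb₁ : Below h r r₁ := .single (.appL hv)
  have hv₁ := hev₁.cell_eq hr hb₁ hv
  have hev := hev₁.of_reach hb₁.reach
  obtain ⟨t', hr₁, hrw⟩ := hev.rewrite hr
  obtain ⟨hwf', hnt'⟩ := Rewrites.wf_hNorm hrw hwf
  obtain ⟨s₁', s₂, rfl, hs₁', hs₂⟩ := hr₁.app_inv hv₁
  obtain rfl := hs₁.unique hs₁'
  obtain ⟨f, v, hd, -, hvf, hnp, hpf, hsf⟩ := hs₁.deref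
  by_cases hlam : ∃ b, v = .lam b
  · obtain ⟨b, rfl⟩ := hlam
    obtain ⟨s, rfl, hs⟩ := hsf.lam_inv hvf
    rw [STerm.WF, STerm.WF] at hwf'
    have hbb : Below g₁ r b :=
      (TransGen.trans_left (.single (.appL hv₁)) hpf.reach).tail (.lam hvf)
    obtain ⟨g₂, hg₂, hev₂, u, hu, hrule⟩ :=
      hr₁.exists_betaContract hwf'.1 hs hs₂ hbb (.single (.appR hv₁))
    have hwf'' : (STerm.app (.lam s) s₂).WF := by rw [STerm.WF, STerm.WF]; exact hwf'
    have hnu := hnt' w n (by rw [STerm.toDB]; exact hnt)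
    rw [STerm.toDB, STerm.toDB] at hnu
    obtain ⟨n', hlt, hn'⟩ := hnu.of_redex
    have hnu' : DB.HNorm w n' u.toDB := by
      obtain ⟨x, y, hxy, hu⟩ := hrule.toDB_eq hwf''
      cases hxy
      rwa [hu]
    obtain ⟨g₃, hg₃, hev₃, s', hs', hnf'⟩ :=
      hn n' hlt _ _ g₂ r w u hu (hrule.wf hwf'') hnu' rfl rfl
    refine ⟨g₃, ?_, (hev.trans hev₂ hr).trans hev₃ hr, s', hs', hnf'⟩
    rw [hnEx, hv]
    change (hnEx h r₁ true).bind _ = _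
    rw [hg₁]
    change (deref g₁ r₁).bind _ = _
    rw [hd]
    change (g₁[f]?).bind _ = _
    rw [hvf]
    change (betaContract g₁ r b r₂).bind _ = _
    rw [hg₂]
    exact hg₃
  · refine ⟨g₁, ?_, hev, _, hr₁, .neutral _ (.app _ ?_)⟩
    · rw [hnEx, hv]
      change (hnEx h r₁ true).bind _ = _
      rw [hg₁]
      change (deref g₁ r₁).bind _ = _
      rw [hd]
      change (g₁[f]?).bind _ = _
      rw [hvf]
      cases v with
      | lam => exact absurd ⟨_, rfl⟩ hlam
      | _ => rfl
    · cases hnf₁ with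
      | neutral _ h => exact h
      | weak s =>
        cases hsf with
        | ptr hx => rw [hx] at hvf; cases hvf; exact absurd rfl (hnp _)
        | lam hx => rw [hx] at hvf; cases hvf; exact absurd ⟨_, rfl⟩ hlam

theorem HnExTerminates.lam {n m : ℕ} (hm : ∀ m' < m, ∀ k, HnExSpec C V n m' k) {h : Heap C V}
    {r r₁ : Ref} {w : Bool} {t : STerm C V} (hr : Represents h r t) (hwf : t.WF)
    (hnt : DB.HNorm w n t.toDB) (hmt : sizeOf t.toDB = m) (hv : h[r]? = some (.lam r₁)) :
    HnExTerminates h r w := by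
  obtain ⟨t₁, rfl, h₁⟩ := hr.lam_inv hv
  cases w with
  | true => exact ⟨h, by rw [hnEx, hv]; rfl, .refl _ _ _, _, hr, .weak _⟩
  | false =>
    rw [STerm.WF] at hwf
    rw [STerm.toDB] at hnt hmt
    obtain ⟨g₁, hg₁, hev₁, s₁, hs₁, hnf₁⟩ :=
      hm _ (by rw [← hmt, DB.lam.sizeOf_spec]; omega) _ h r₁ false t₁ h₁ hwf hnt.of_lam rfl rfl
    have hb₁ : Below h r r₁ := .single (.lam hv)
    refine ⟨g₁, ?_, hev₁.of_reach hb₁.reach, _, .lam (hev₁.cell_eq hr hb₁ hv) hs₁, .lam hnf₁⟩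
    rw [hnEx, hv]
    exact hg₁

theorem HnExTerminates.susp {n m k : ℕ} (hk : ∀ k' < k, HnExSpec C V n m k') {h : Heap C V}
    {r q : Ref} {ol nl : ℤ} {env : List EItem} {w : Bool} {t : STerm C V}
    (hr : Represents h r t) (hwf : t.WF) (hnt : DB.HNorm w n t.toDB) (hmt : sizeOf t.toDB = m)
    (hkt : t.readCost = k) (hv : h[r]? = some (.susp q ol nl env)) : HnExTerminates h r w := by
  obtain ⟨g₁, hg₁, hev₁, hs⟩ := hr.lazyRead hwf
  obtain ⟨s, hs, hlt⟩ := hs _ _ _ _ hv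
  obtain ⟨s', hs', hrd⟩ := hev₁.rewrite hr
  obtain rfl := hs.unique hs'
  obtain ⟨hwf', heq⟩ := Reads.wf_toDB hrd hwf
  obtain ⟨g₂, hg₂, hev₂, hres⟩ :=
    hk _ (hkt ▸ hlt) g₁ r w s hs hwf' (heq ▸ hnt) (heq ▸ hmt) rfl
  refine ⟨g₂, ?_, (hev₁.mono fun _ _ => Or.inl).trans hev₂ hr, hres⟩
  rw [hnEx, hv]
  change (lazyRead h r).bind _ = _
  rw [hg₁]
  exact hg₂

/-- The recursion of head normalization terminates by the lexicographic order on the number of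
remaining head reduction steps, the size of the de Bruijn term, and the reading cost. -/
theorem hnExSpec (n m k : ℕ) : HnExSpec C V n m k := by
  induction n using Nat.strong_induction_on generalizing m k with
  | _ n hn =>
  induction m using Nat.strong_induction_on generalizing k with
  | _ m hm =>
  induction k using Nat.strong_induction_on with
  | _ k hk =>
  intro h r w t hr hwf hnt hmt hkt
  obtain ⟨r', v, -, -, hv, hnp, hp, hr'⟩ := hr.deref
  refine .of_ptrPath hr hp ?_
  cases v with
  | const c =>
    obtain rfl := hr'.const_inv hv
    exact ⟨h, by rw [hnEx, hv]; rfl, .refl _ _ _, _, hr', .neutral _ (.const c)⟩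
  | fv x =>
    obtain rfl := hr'.fv_inv hv
    exact ⟨h, by rw [hnEx, hv]; rfl, .refl _ _ _, _, hr', .neutral _ (.fvar x)⟩
  | bv i =>
    obtain ⟨j, -, rfl⟩ := hr'.bv_inv hv
    exact ⟨h, by rw [hnEx, hv]; rfl, .refl _ _ _, _, hr', .neutral _ (.bvar j)⟩
  | ptr x => exact absurd rfl (hnp x)
  | lam => exact .lam hm hr' hwf hnt hmt hv
  | app => exact .app hn hm hr' hwf hnt hmt hv
  | susp => exact .susp hk hr' hwf hnt hmt hkt hv

end SuspNotation

theorem mainTheorem3 {C V : Type} (h : SuspNotation.Heap C V) (r : SuspNotation.Ref)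
    (t : SuspNotation.STerm C V) (d : SuspNotation.DB C V)
    (hr : SuspNotation.Represents h r t) (hwf : t.WF)
    (hd : SuspNotation.Reads t d.toSTerm) (hd' : d.HasHNF) :
    ∃ h' : SuspNotation.Heap C V, SuspNotation.headNorm2 h r = some h' ∧
      ∃ s : SuspNotation.STerm C V,
        SuspNotation.Represents h' r s ∧ SuspNotation.Rewrites t s ∧ s.GHNF := by
  obtain ⟨n, hn⟩ := hd'.hNorm
  rw [← d.toDB_toSTerm, ← (hd.wf_toDB hwf).2] at hn
  obtain ⟨h', he, hev, s, hs, hnf⟩ := SuspNotation.hnExSpec n _ _ h r false t hr hwf hn rfl rfl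
  obtain ⟨s', hs', hrw⟩ := hev.rewrite hr
  obtain rfl := hs.unique hs'
  exact ⟨h', he, s, hs, hrw, hnf.ghnf⟩
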